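/- For $\nu\in\mathbb R$ and $x>0$ let $$\mathbf L_\nu(x)=\sum_{k=0}^\infty\frac{(x/2)^{\nu+2k+1}}{\Gamma(k+\frac32)\,\Gamma(k+\nu+\frac32)}$$ be the modified Struve function of the first kind (with $1/\Gamma=0$ at the poles of $\Gamma$). **Theorem.** Let $n>-1$, $\nu$ and $\gamma\ge 0$ be real numbers. The integrals in (1)–(7) below converge in the stated ranges of the parameters: $\int_0^x e^{-\gamma t}t^\nu\mathbf L_{\nu+n}(t)\,dt$ for $\nu>-\frac12(n+2)$, and $\int_0^x e^{-\gamma t}t^{\nu+1}\mathbf L_\nu(t)\,dt$ for $\nu>-\frac32$. For all $x>0$: 1. if $\nu>-\frac12(n+2)$, then $\displaystyle\int_0^x e^{-\gamma t}t^\nu\mathbf L_{\nu+n}(t)\,dt> e^{-\gamma x}x^\nu\mathbf L_{\nu+n+1}(x)$; 2. if $\nu\ge\frac12$, then $\displaystyle\int_0^x t^\nu\mathbf L_\nu(t)\,dt<x^\nu\mathbf L_\nu(x)$; 3. if $\nu>-\frac12(n+1)$, then $$\int_0^x t^\nu\mathbf L_{\nu+n}(t)\,dt<\frac{x^\nu}{2\nu+n+1}\bigg(2(\nu+n+1)\mathbf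 L_{\nu+n+1}(x)-(n+1)\mathbf L_{\nu+n+3}(x)-\frac{(n+1)x^{\nu+n+2}}{\sqrt\pi\,2^{\nu+n+1}(2\nu+n+2)\Gamma(\nu+n+\frac52)}\bigg);$$ 4. if $\gamma<1$ and $\nu\ge\frac12$, then $\displaystyle\int_0^x e^{-\gamma t}t^\nu\mathbf L_\nu(t)\,dt\le\frac{e^{-\gamma x}}{1-\gamma}\int_0^x t^\nu\mathbf L_\nu(t)\,dt$; 5. if $\gamma<1$ and $\nu\ge\frac12$, then $$\int_0^x e^{-\gamma t}t^\nu\mathbf L_\nu(t)\,dt<\frac{e^{-\gamma x}x^\nu}{(2\nu+1)(1-\gamma)}\bigg(2(\nu+1)\mathbf L_{\nu+1}(x)-\mathbf L_{\nu+3}(x)-\frac{x^{\nu+2}}{\sqrt\pi\,2^{\nu+2}(\nu+1)\Gamma(\nu+\frac52)}\bigg);$$ 6. if $\nu>-\frac32$, then $\displaystyle\int_0^x e^{-\gamma t}t^{\nu+1}\mathbf L_\nu(t)\,dt\ge e^{-\gamma x}x^{\nu+1}\mathbf L_{\nu+1}(x)$; 7. if $\gamma<1$ and $\nu>-\frac12$,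 then $\displaystyle\int_0^x e^{-\gamma t}t^{\nu+1}\mathbf L_\nu(t)\,dt\le\frac1{1-\gamma}e^{-\gamma x}x^{\nu+1}\mathbf L_{\nu+1}(x)$. In each of (4), (6) and (7), and for each $x>0$, equality holds if and only if $\gamma=0$. For every fixed admissible choice of the parameters, the multiplicative constants in (2)–(7), namely $1$, $\frac1{2\nu+n+1}$, $\frac1{1-\gamma}$, $\frac1{(2\nu+1)(1-\gamma)}$, $1$ and $\frac1{1-\gamma}$ respectively, cannot be improved, and neither can the constant $1$ in (1) if $\gamma=0$. That is, if the constant is replaced by a real number $C$ and the resulting bound, read with a non-strict inequality, holds for all $x>0$, then $C$ is at least the given constant in the upper bounds (2)–(5) and (7), and at most the given constant in the lower bounds (1) and (6). -/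

import Mathlib

/-- The modified Struve function of the first kind `𝐋_ν(x)`, used for `x > 0`, defined by
`∑_{k ≥ 0} (x/2)^(ν+2k+1) / (Γ(k+3/2) Γ(k+ν+3/2))`.
At a pole of `Γ` Mathlib has `Γ = 0`, and division by zero gives zero, so the term there is `0`,
in agreement with the usual convention `1/Γ = 0` at the poles. -/
noncomputable def struveL (ν x : ℝ) : ℝ :=
  ∑' k : ℕ, (x / 2) ^ (ν + 2 * (k : ℝ) + 1) /
    (Real.Gamma ((k : ℝ) + 3 / 2) * Real.Gamma ((k : ℝ) + ν + 3 / 2))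

/-- The defining series converges for every real order and every positive argument. -/
theorem summable_struveL (ν : ℝ) {x : ℝ} (hx : 0 < x) :
    Summable (fun k : ℕ => (x / 2) ^ (ν + 2 * (k : ℝ) + 1) /
      (Real.Gamma ((k : ℝ) + 3 / 2) * Real.Gamma ((k : ℝ) + ν + 3 / 2))) := by
  have hx2 : 0 < x / 2 := by positivity
  have hpos : ∀ᶠ k : ℕ in Filter.atTop, 0 < (k : ℝ) + ν + 3 / 2 := by
    have h := (tendsto_natCast_atTop_atTop (R := ℝ)).eventually_gt_atTop (-ν - 3 / 2)
    filter_upwards [h] with k hk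
    linarith
  refine summable_of_ratio_test_tendsto_lt_one (l := 0) one_pos ?_ ?_
  · filter_upwards [hpos] with k hk
    have h1 := Real.Gamma_pos_of_pos (show (0 : ℝ) < (k : ℝ) + 3 / 2 by positivity)
    have h2 := Real.Gamma_pos_of_pos hk
    positivity
  · have hlim : Filter.Tendsto
        (fun k : ℕ => (x / 2) ^ 2 / (((k : ℝ) + 3 / 2) * ((k : ℝ) + ν + 3 / 2)))
        Filter.atTop (nhds 0) := by
      refine Filter.Tendsto.div_atTop tendsto_const_nhds ?_
      refine Filter.Tendsto.atTop_mul_atTop₀ ?_ ?_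
      · exact Filter.tendsto_atTop_add_const_right _ _ tendsto_natCast_atTop_atTop
      · exact Filter.tendsto_atTop_add_const_right _ _
          (Filter.tendsto_atTop_add_const_right _ _ tendsto_natCast_atTop_atTop)
    refine hlim.congr' ?_
    filter_upwards [hpos] with k hk
    have hk1 : (0 : ℝ) < (k : ℝ) + 3 / 2 := by positivity
    have h1 := Real.Gamma_pos_of_pos hk1
    have h2 := Real.Gamma_pos_of_pos hk
    have e1 : Real.Gamma (((k + 1 : ℕ) : ℝ) + 3 / 2)
        = ((k : ℝ) + 3 / 2) * Real.Gamma ((k : ℝ) + 3 / 2) := by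
      rw [← Real.Gamma_add_one hk1.ne']; congr 1; push_cast; ring
    have e2 : Real.Gamma (((k + 1 : ℕ) : ℝ) + ν + 3 / 2)
        = ((k : ℝ) + ν + 3 / 2) * Real.Gamma ((k : ℝ) + ν + 3 / 2) := by
      rw [← Real.Gamma_add_one hk.ne']; congr 1; push_cast; ring
    have e3 : (x / 2) ^ (ν + 2 * ((k + 1 : ℕ) : ℝ) + 1)
        = (x / 2) ^ (ν + 2 * (k : ℝ) + 1) * (x / 2) ^ 2 := by
      rw [← Real.rpow_natCast (x / 2) 2, ← Real.rpow_add hx2]; congr 1; push_cast; ring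
    rw [e1, e2, e3]
    have h3 : 0 < (x / 2) ^ (ν + 2 * (k : ℝ) + 1) := Real.rpow_pos_of_pos hx2 _
    rw [Real.norm_of_nonneg (by positivity), Real.norm_of_nonneg (by positivity)]
    generalize Real.Gamma ((k : ℝ) + 3 / 2) = a at *
    generalize Real.Gamma ((k : ℝ) + ν + 3 / 2) = b at *
    have hk1' := hk1.ne'
    have hk' := hk.ne'
    generalize (k : ℝ) + 3 / 2 = p at *
    generalize (k : ℝ) + ν + 3 / 2 = q at *
    field_simp

/-!
All functions involved are generalised power series `∑ₖ bₖ x ^ (α + 2k)` (`evenSeries`) with positive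
coefficients, which may be differentiated and integrated termwise on `(0, ∞)`. Two such series with
the same exponents are compared through their coefficients: a termwise inequality gives an
inequality of the sums, and if the quotient of the coefficients tends to `l`, so does the quotient
of the sums as `x → ∞` (`tendsto_evenSeries_div`). This settles the lower bound by
`x ^ ν L_{ν+n+1}` and the three-term upper bound, together with the optimality of their constants.
In the three-term bound the coefficients at `k = 0` agree, which is the purpose of the third term,
and those at `k ≥ 1` satisfy a strict inequality.

The bounds comparing `∫₀ˣ t ^ ν L_ν` with `x ^ ν L_ν(x)`, and `x ^ (ν+1) L_{ν+1}` with its derivative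
`x ^ (ν+1) L_ν`, relate series whose exponents have different parity. Both say `u < u'`
for a series `u` with `u(0) = u'(0) = 0`. Here `u''` has the same parity as `u`, and the
coefficients show `u'' > u` and `u'' / u → 1`. The first gives `(exp x (u' - u))' > 0`, hence
`u < u'` (`lt_deriv_of_lt_deriv_deriv`); the second makes `exp (κ x) (u' - κ u)` eventually
decreasing for each `κ > 1`, hence `u' / u → 1` (`tendsto_deriv_div`).

For the damped integrals, `exp (-γ x) u(x) = ∫₀ˣ exp (-γ t) (u' - γ u)` and `u < u'` give
`(1 - γ) ∫₀ˣ exp (-γ t) u' ≤ exp (-γ x) u(x)`, strictly unless `γ = 0`; that `1 / (1 - γ)` is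
optimal follows from `u' / u → 1` (`inv_le_of_integral_exp_mul_deriv_le`).
-/

open Filter Set Topology

/-! ### Generalised power series with steps of two -/

/-- The generalised power series `∑ₖ bₖ x ^ (α + 2k)`, with real leading exponent `α`. It is meant
for `x > 0`, and for `x ≥ 0` when `α > 0`, where its value at `0` is `0`. -/
noncomputable def evenSeries (b : ℕ → ℝ) (α x : ℝ) : ℝ := ∑' k : ℕ, b k * x ^ (α + 2 * (k : ℝ))

/-- The terms of `evenSeries b α` are summable at every positive argument. -/
def EvenSummable (b : ℕ → ℝ) (α : ℝ) : Prop :=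
  ∀ x : ℝ, 0 < x → Summable fun k : ℕ => b k * x ^ (α + 2 * (k : ℝ))

/-- The coefficients of the derivative of `evenSeries b α`, a series with leading exponent
`α - 1`. -/
def derivCoeff (b : ℕ → ℝ) (α : ℝ) (k : ℕ) : ℝ := (α + 2 * (k : ℝ)) * b k

/-- The coefficients of `evenSeries b α` written with leading exponent `α - 2`, the new leading
coefficient being `0`. -/
def shiftCoeff (b : ℕ → ℝ) : ℕ → ℝ
  | 0 => 0
  | k + 1 => b k

theorem EvenSummable.shift {b : ℕ → ℝ} {α : ℝ} (h : EvenSummable b α) :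
    EvenSummable (shiftCoeff b) (α - 2) := by
  intro x hx
  rw [← summable_nat_add_iff 1]
  refine (h x hx).congr fun k => ?_
  simp only [shiftCoeff]
  push_cast
  ring_nf

theorem evenSeries_shift {b : ℕ → ℝ} {α : ℝ} (h : EvenSummable b α) {x : ℝ} (hx : 0 < x) :
    evenSeries (shiftCoeff b) (α - 2) x = evenSeries b α x := by
  rw [evenSeries, (h.shift x hx).tsum_eq_zero_add, evenSeries]
  simp only [shiftCoeff, zero_mul, zero_add]
  refine tsum_congr fun k => ?_
  push_cast
  ring_nf

theorem evenSeries_pos {b : ℕ → ℝ} {α : ℝ} (hb : ∀ k, 0 < b k) (hs : EvenSummable b α) {x : ℝ}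
    (hx : 0 < x) : 0 < evenSeries b α x :=
  (hs x hx).tsum_pos (fun k => (mul_pos (hb k) (Real.rpow_pos_of_pos hx _)).le) 0
    (mul_pos (hb 0) (Real.rpow_pos_of_pos hx _))

theorem evenSeries_lt {b c : ℕ → ℝ} {α : ℝ} (hb : EvenSummable b α) (hc : EvenSummable c α)
    (hle : ∀ k, b k ≤ c k) {i : ℕ} (hlt : b i < c i) {x : ℝ} (hx : 0 < x) :
    evenSeries b α x < evenSeries c α x :=
  Summable.tsum_lt_tsum
    (fun k => mul_le_mul_of_nonneg_right (hle k) (Real.rpow_pos_of_pos hx _).le)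
    (mul_lt_mul_of_pos_right hlt (Real.rpow_pos_of_pos hx _)) (hb x hx) (hc x hx)

/-- The `k`-th term of the derived series at `x` is at most `x⁻¹` times the `k`-th term of the
series itself at `e x`, because `p ≤ e ^ p`. -/
theorem derivCoeff_mul_rpow_le {b : ℕ → ℝ} {α : ℝ} (hb : ∀ k, 0 ≤ b k) {x : ℝ} (hx : 0 < x)
    (k : ℕ) : derivCoeff b α k * x ^ (α - 1 + 2 * (k : ℝ)) ≤
      x⁻¹ * (b k * (Real.exp 1 * x) ^ (α + 2 * (k : ℝ))) := by
  have e1 : x ^ (α - 1 + 2 * (k : ℝ)) = x⁻¹ * x ^ (α + 2 * (k : ℝ)) := by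
    rw [← Real.rpow_neg_one x, ← Real.rpow_add hx]; ring_nf
  have h2 : α + 2 * (k : ℝ) ≤ Real.exp (α + 2 * (k : ℝ)) := by
    linarith [Real.add_one_le_exp (α + 2 * (k : ℝ))]
  rw [e1, Real.mul_rpow (Real.exp_pos 1).le hx.le, Real.exp_one_rpow, derivCoeff]
  have h3 : 0 ≤ x⁻¹ * (b k * x ^ (α + 2 * (k : ℝ))) :=
    mul_nonneg (inv_pos.2 hx).le (mul_nonneg (hb k) (Real.rpow_pos_of_pos hx _).le)
  calc _ = (α + 2 * (k : ℝ)) * (x⁻¹ * (b k * x ^ (α + 2 * (k : ℝ)))) := by ring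
    _ ≤ Real.exp (α + 2 * (k : ℝ)) * (x⁻¹ * (b k * x ^ (α + 2 * (k : ℝ)))) :=
      mul_le_mul_of_nonneg_right h2 h3
    _ = _ := by ring

theorem derivCoeff_nonneg {b : ℕ → ℝ} {α : ℝ} (hα : 0 ≤ α) (hb : ∀ k, 0 ≤ b k) (k : ℕ) :
    0 ≤ derivCoeff b α k :=
  mul_nonneg (by positivity) (hb k)

theorem derivCoeff_pos {b : ℕ → ℝ} {α : ℝ} (hα : 0 < α) (hb : ∀ k, 0 < b k) (k : ℕ) :
    0 < derivCoeff b α k :=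
  mul_pos (by positivity) (hb k)

theorem EvenSummable.deriv {b : ℕ → ℝ} {α : ℝ} (hα : 0 ≤ α) (hb : ∀ k, 0 ≤ b k)
    (hs : EvenSummable b α) : EvenSummable (derivCoeff b α) (α - 1) := fun _ hx =>
  Summable.of_nonneg_of_le
    (fun k => mul_nonneg (derivCoeff_nonneg hα hb k) (Real.rpow_pos_of_pos hx _).le)
    (derivCoeff_mul_rpow_le hb hx) ((hs _ (mul_pos (Real.exp_pos 1) hx)).mul_left _)

theorem hasDerivAt_evenSeries {b : ℕ → ℝ} {α : ℝ} (hα : 0 ≤ α) (hb : ∀ k, 0 ≤ b k)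
    (hs : EvenSummable b α) {x : ℝ} (hx : 0 < x) :
    HasDerivAt (evenSeries b α) (evenSeries (derivCoeff b α) (α - 1) x) x := by
  have hmem : x ∈ Ioo (x / 2) (2 * x) := ⟨by linarith, by linarith⟩
  refine hasDerivAt_tsum_of_isPreconnected (t := Ioo (x / 2) (2 * x))
    (g := fun (k : ℕ) (y : ℝ) => b k * y ^ (α + 2 * (k : ℝ)))
    (g' := fun (k : ℕ) (y : ℝ) => derivCoeff b α k * y ^ (α - 1 + 2 * (k : ℝ)))
    (u := fun k : ℕ => (x / 2)⁻¹ * (b k * (Real.exp 1 * (2 * x)) ^ (α + 2 * (k : ℝ))))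
    ((hs _ (by positivity)).mul_left _) isOpen_Ioo isPreconnected_Ioo ?_ ?_ hmem (hs x hx) hmem
  · intro k y hy
    have hy0 : 0 < y := by linarith [hy.1]
    have h := ((Real.hasDerivAt_rpow_const (p := α + 2 * (k : ℝ)) (Or.inl hy0.ne')).const_mul (b k))
    have e : derivCoeff b α k * y ^ (α - 1 + 2 * (k : ℝ)) =
        b k * ((α + 2 * (k : ℝ)) * y ^ (α + 2 * (k : ℝ) - 1)) := by
      rw [show α - 1 + 2 * (k : ℝ) = α + 2 * (k : ℝ) - 1 by ring, derivCoeff]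
      ring
    rw [← e] at h
    exact h
  · intro k y hy
    have hy0 : 0 < y := by linarith [hy.1]
    rw [Real.norm_of_nonneg
      (mul_nonneg (derivCoeff_nonneg hα hb k) (Real.rpow_pos_of_pos hy0 _).le)]
    refine (derivCoeff_mul_rpow_le hb hy0 k).trans ?_
    refine mul_le_mul ?_ ?_ (mul_nonneg (hb k) (Real.rpow_nonneg (by positivity) _))
      (by positivity)
    · exact inv_anti₀ (by positivity) hy.1.le
    · refine mul_le_mul_of_nonneg_left (Real.rpow_le_rpow (by positivity) ?_ (by positivity)) (hb k)
      exact mul_le_mul_of_nonneg_left hy.2.le (Real.exp_pos 1).le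

theorem evenSeries_zero {α : ℝ} (hα : 0 < α) (b : ℕ → ℝ) : evenSeries b α 0 = 0 := by
  have h : ∀ k : ℕ, b k * (0 : ℝ) ^ (α + 2 * (k : ℝ)) = 0 := fun k => by
    rw [Real.zero_rpow (by positivity), mul_zero]
  simp only [evenSeries, h, tsum_zero]

theorem continuousOn_evenSeries {b : ℕ → ℝ} {α : ℝ} (hα : 0 < α) (hb : ∀ k, 0 ≤ b k)
    (hs : EvenSummable b α) {x : ℝ} (hx : 0 < x) : ContinuousOn (evenSeries b α) (Icc 0 x) := by
  refine continuousOn_tsum (u := fun k : ℕ => b k * x ^ (α + 2 * (k : ℝ))) ?_ (hs x hx) ?_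
  · intro k
    exact continuousOn_const.mul
      (Real.continuous_rpow_const (by positivity)).continuousOn
  · intro k y hy
    rw [Real.norm_of_nonneg (mul_nonneg (hb k) (Real.rpow_nonneg hy.1 _))]
    exact mul_le_mul_of_nonneg_left (Real.rpow_le_rpow hy.1 hy.2 (by positivity)) (hb k)

/-- If the quotients of the coefficients of two series with the same exponents tend to `l`, so does
the quotient of the sums at infinity: the part of the sums below any fixed index is negligible
against the next term of the denominator, whose coefficients are positive. -/
theorem tendsto_evenSeries_div {b c : ℕ → ℝ} {α l : ℝ} (hb : ∀ k, 0 < b k)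
    (hsb : EvenSummable b α) (hsc : EvenSummable c α)
    (hl : Tendsto (fun k => c k / b k) atTop (𝓝 l)) :
    Tendsto (fun x => evenSeries c α x / evenSeries b α x) atTop (𝓝 l) := by
  rw [Metric.tendsto_nhds]
  intro ε hε
  obtain ⟨N, hN⟩ := eventually_atTop.1 ((Metric.tendsto_nhds.1 hl) (ε / 2) (by positivity))
  set A : ℝ := ∑ k ∈ Finset.range N, |c k - l * b k| with hA
  have hA0 : 0 ≤ A := Finset.sum_nonneg fun _ _ => abs_nonneg _
  have hlim : Tendsto (fun x : ℝ => A / b N * x ^ (-2 : ℝ)) atTop (𝓝 0) := by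
    simpa using (tendsto_rpow_neg_atTop (show (0 : ℝ) < 2 by norm_num)).const_mul (A / b N)
  filter_upwards [eventually_ge_atTop (1 : ℝ), hlim.eventually_lt_const (half_pos hε)] with x hx hxA
  have hx0 : 0 < x := by linarith
  have hp : ∀ p : ℝ, 0 < x ^ p := fun p => Real.rpow_pos_of_pos hx0 p
  have hg : 0 < evenSeries b α x := evenSeries_pos hb hsb hx0
  have hbound : HasSum (fun k : ℕ => ε / 2 * (b k * x ^ (α + 2 * (k : ℝ))) +
      if k ∈ Finset.range N then |c k - l * b k| * x ^ (α + 2 * (k : ℝ)) else 0)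
      (ε / 2 * evenSeries b α x +
        ∑ k ∈ Finset.range N, |c k - l * b k| * x ^ (α + 2 * (k : ℝ))) := by
    refine ((hsb x hx0).hasSum.mul_left _).add ?_
    have h := hasSum_sum_of_ne_finset_zero (L := SummationFilter.unconditional ℕ)
      (f := fun k : ℕ => if k ∈ Finset.range N then |c k - l * b k| * x ^ (α + 2 * (k : ℝ)) else 0)
      (s := Finset.range N) (fun k hk => if_neg hk)
    rwa [Finset.sum_congr rfl (fun k hk => if_pos hk)] at h
  have hdiff : evenSeries c α x - l * evenSeries b α x =
      ∑' k : ℕ, (c k - l * b k) * x ^ (α + 2 * (k : ℝ)) := by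
    refine (HasSum.tsum_eq ?_).symm
    simpa only [sub_mul, mul_assoc, evenSeries] using
      (hsc x hx0).hasSum.sub ((hsb x hx0).hasSum.mul_left l)
  have h1 : |evenSeries c α x - l * evenSeries b α x| ≤ ε / 2 * evenSeries b α x +
      ∑ k ∈ Finset.range N, |c k - l * b k| * x ^ (α + 2 * (k : ℝ)) := by
    rw [hdiff, ← Real.norm_eq_abs]
    refine tsum_of_norm_bounded hbound fun k => ?_
    rw [norm_mul, Real.norm_of_nonneg (hp _).le, Real.norm_eq_abs]
    split_ifs with hk
    · have := mul_pos (hb k) (hp (α + 2 * (k : ℝ)))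
      have : 0 < ε / 2 * (b k * x ^ (α + 2 * (k : ℝ))) := by positivity
      linarith
    · have h := hN k (by simpa using hk)
      rw [Real.dist_eq] at h
      have h' : |c k - l * b k| ≤ ε / 2 * b k := by
        have e : c k - l * b k = (c k / b k - l) * b k := by
          have := (hb k).ne'
          field_simp
        rw [e, abs_mul, abs_of_pos (hb k)]
        exact mul_le_mul_of_nonneg_right h.le (hb k).le
      rw [add_zero, ← mul_assoc]
      exact mul_le_mul_of_nonneg_right h' (hp _).le
  have h2 : ∑ k ∈ Finset.range N, |c k - l * b k| * x ^ (α + 2 * (k : ℝ)) ≤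
      A / b N * x ^ (-2 : ℝ) * evenSeries b α x := by
    calc _ ≤ ∑ k ∈ Finset.range N, |c k - l * b k| * x ^ (α + 2 * (N : ℝ) - 2) := by
          refine Finset.sum_le_sum fun k hk => mul_le_mul_of_nonneg_left ?_ (abs_nonneg _)
          refine Real.rpow_le_rpow_of_exponent_le hx ?_
          have : (k : ℝ) + 1 ≤ N := by exact_mod_cast Finset.mem_range.1 hk
          linarith
      _ = A / b N * x ^ (-2 : ℝ) * (b N * x ^ (α + 2 * (N : ℝ))) := by
          rw [← Finset.sum_mul, ← hA, sub_eq_add_neg, Real.rpow_add hx0]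
          have := (hb N).ne'
          field_simp
      _ ≤ _ := by
          have := hb N
          have := hp (-2)
          refine mul_le_mul_of_nonneg_left ?_ (by positivity)
          exact (hsb x hx0).le_tsum N fun k _ => (mul_pos (hb k) (hp _)).le
  rw [Real.dist_eq, show evenSeries c α x / evenSeries b α x - l =
    (evenSeries c α x - l * evenSeries b α x) / evenSeries b α x by field_simp, abs_div,
    abs_of_pos hg, div_lt_iff₀ hg]
  have h3 : A / b N * x ^ (-2 : ℝ) * evenSeries b α x < ε / 2 * evenSeries b α x :=
    mul_lt_mul_of_pos_right hxA hg
  linarith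

/-! ### Comparing a function with its derivative -/

/-- If `u(0) = u'(0) = 0` and `u'' > u` on `(0, ∞)`, then `u' > u` there: the function
`exp x * (u' x - u x)` has derivative `exp x * (u'' x - u x) > 0`. -/
theorem lt_deriv_of_lt_deriv_deriv {u v w : ℝ → ℝ} (huc : ∀ x, 0 < x → ContinuousOn u (Icc 0 x))
    (hvc : ∀ x, 0 < x → ContinuousOn v (Icc 0 x)) (hu0 : u 0 = 0) (hv0 : v 0 = 0)
    (hu : ∀ x, 0 < x → HasDerivAt u (v x) x) (hv : ∀ x, 0 < x → HasDerivAt v (w x) x)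
    (hlt : ∀ x, 0 < x → u x < w x) {x : ℝ} (hx : 0 < x) : u x < v x := by
  have hd : ∀ y, 0 < y → HasDerivAt (fun y => Real.exp y * (v y - u y))
      (Real.exp y * (w y - u y)) y := fun y hy => by
    refine ((Real.hasDerivAt_exp y).mul ((hv y hy).sub (hu y hy))).congr_deriv ?_
    simp only [Pi.sub_apply]
    ring
  have hm : StrictMonoOn (fun y => Real.exp y * (v y - u y)) (Icc 0 x) := by
    refine strictMonoOn_of_deriv_pos (convex_Icc 0 x)
      (Real.continuous_exp.continuousOn.mul ((hvc x hx).sub (huc x hx))) fun y hy => ?_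
    rw [interior_Icc] at hy
    rw [(hd y hy.1).deriv]
    exact mul_pos (Real.exp_pos y) (sub_pos.2 (hlt y hy.1))
  have h := hm (left_mem_Icc.2 hx.le) (right_mem_Icc.2 hx.le) hx
  simp only [hu0, hv0, sub_self, mul_zero] at h
  exact sub_pos.1 (pos_of_mul_pos_right h (Real.exp_pos x).le)

/-- If `0 < u < u'` on `(0, ∞)` then `exp (-γ x) * u x` tends to infinity for every `γ < 1`. -/
theorem tendsto_exp_mul_atTop {u v : ℝ → ℝ} (hu : ∀ x, 0 < x → HasDerivAt u (v x) x)
    (hpos : ∀ x, 0 < x → 0 < u x) (hlt : ∀ x, 0 < x → u x < v x) {γ : ℝ} (hγ : γ < 1) :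
    Tendsto (fun x => Real.exp (-γ * x) * u x) atTop atTop := by
  have hd : ∀ y, 0 < y → HasDerivAt (fun y => Real.exp (-y) * u y)
      (Real.exp (-y) * (v y - u y)) y := fun y hy => by
    refine (((hasDerivAt_neg y).exp).mul (hu y hy)).congr_deriv ?_
    ring
  have hm : MonotoneOn (fun y => Real.exp (-y) * u y) (Ici 1) := by
    have hpos1 : ∀ y ∈ Ici (1 : ℝ), 0 < y := fun y hy => lt_of_lt_of_le one_pos hy
    refine monotoneOn_of_deriv_nonneg (convex_Ici 1)
      (fun y hy => (hd y (hpos1 y hy)).continuousAt.continuousWithinAt)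
      (fun y hy => (hd y (hpos1 y (interior_subset hy))).differentiableAt.differentiableWithinAt)
      fun y hy => ?_
    have hy' := hpos1 y (interior_subset hy)
    rw [(hd y hy').deriv]
    exact mul_nonneg (Real.exp_pos _).le (sub_pos.2 (hlt y hy')).le
  have h1 : Tendsto (fun x : ℝ => Real.exp ((1 - γ) * x) * (Real.exp (-1) * u 1)) atTop atTop :=
    (Real.tendsto_exp_atTop.comp (tendsto_id.const_mul_atTop (sub_pos.2 hγ))).atTop_mul_const
      (mul_pos (Real.exp_pos _) (hpos 1 one_pos))
  refine tendsto_atTop_mono' _ ?_ h1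
  filter_upwards [eventually_ge_atTop (1 : ℝ)] with x hx
  have h := mul_le_mul_of_nonneg_left (hm (mem_Ici.2 le_rfl) (mem_Ici.2 hx) hx)
    (Real.exp_pos ((1 - γ) * x)).le
  refine h.trans_eq ?_
  simp only
  rw [← mul_assoc, ← Real.exp_add]
  ring_nf

/-- If `0 < u < u'` and `u'' / u → 1` at infinity, then `u' / u → 1`: for `κ > 1` the function
`exp (κ x) * (u' x - κ * u x)` is eventually decreasing, hence bounded above, so that
`u' / u ≤ κ + o(1)`. -/
theorem tendsto_deriv_div {u v w : ℝ → ℝ}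
    (hu : ∀ x, 0 < x → HasDerivAt u (v x) x) (hv : ∀ x, 0 < x → HasDerivAt v (w x) x)
    (hpos : ∀ x, 0 < x → 0 < u x) (hlt : ∀ x, 0 < x → u x < v x)
    (hw : Tendsto (fun x => w x / u x) atTop (𝓝 1)) :
    Tendsto (fun x => v x / u x) atTop (𝓝 1) := by
  have hutop : Tendsto u atTop atTop := by
    simpa using tendsto_exp_mul_atTop hu hpos hlt (γ := 0) one_pos
  refine tendsto_order.2 ⟨fun a ha => ?_, fun κ' hκ' => ?_⟩
  · filter_upwards [eventually_gt_atTop (0 : ℝ)] with x hx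
    exact ha.trans ((one_lt_div (hpos x hx)).2 (hlt x hx))
  obtain ⟨κ, hκ1, hκ⟩ := exists_between hκ'
  have hκ0 : 0 < κ := by linarith
  obtain ⟨X, hX⟩ := eventually_atTop.1
    ((hw.eventually_lt_const (show (1 : ℝ) < κ ^ 2 by nlinarith)).and (eventually_gt_atTop (0 : ℝ)))
  have hd : ∀ y, 0 < y → HasDerivAt (fun y => Real.exp (κ * y) * (v y - κ * u y))
      (Real.exp (κ * y) * (w y - κ ^ 2 * u y)) y := fun y hy => by
    refine ((((hasDerivAt_id y).const_mul κ).exp).mul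
      ((hv y hy).sub ((hu y hy).const_mul κ))).congr_deriv ?_
    simp only [Pi.sub_apply, id]
    ring
  have hanti : AntitoneOn (fun y => Real.exp (κ * y) * (v y - κ * u y)) (Ici X) := by
    refine antitoneOn_of_deriv_nonpos (convex_Ici X)
      (fun y hy => (hd y (hX y hy).2).continuousAt.continuousWithinAt)
      (fun y hy => (hd y (hX y (interior_subset hy)).2).differentiableAt.differentiableWithinAt)
      fun y hy => ?_
    obtain ⟨h1, h2⟩ := hX y (interior_subset hy)
    rw [(hd y h2).deriv]
    rw [div_lt_iff₀ (hpos y h2)] at h1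
    exact mul_nonpos_of_nonneg_of_nonpos (Real.exp_pos _).le (by linarith)
  set M := Real.exp (κ * X) * (v X - κ * u X) with hM
  have hsmall : Tendsto (fun x => |M| / u x) atTop (𝓝 0) := hutop.const_div_atTop |M|
  filter_upwards [eventually_ge_atTop X, hsmall.eventually_lt_const (sub_pos.2 hκ)] with x hx hxM
  have hx0 := (hX x hx).2
  have h1 : Real.exp (κ * x) * (v x - κ * u x) ≤ M := hanti (mem_Ici.2 le_rfl) hx hx
  have h2 : v x - κ * u x ≤ |M| := by
    by_contra! h
    have h3 : (1 : ℝ) ≤ Real.exp (κ * x) := Real.one_le_exp (by positivity)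
    have h4 : v x - κ * u x ≤ Real.exp (κ * x) * (v x - κ * u x) :=
      le_mul_of_one_le_left ((abs_nonneg M).trans h.le) h3
    linarith [le_abs_self M]
  have hux := hpos x hx0
  rw [div_lt_iff₀ hux] at hxM ⊢
  linarith

/-! ### Exponentially damped integrals of a derivative -/

theorem intervalIntegrable_exp_mul {v : ℝ → ℝ} {x : ℝ} (γ : ℝ)
    (hv : IntervalIntegrable v MeasureTheory.volume 0 x) :
    IntervalIntegrable (fun t => Real.exp (-γ * t) * v t) MeasureTheory.volume 0 x :=
  hv.continuousOn_mul (by fun_prop)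

theorem intervalIntegrable_deriv {u v : ℝ → ℝ} (huc : ∀ x, 0 < x → ContinuousOn u (Icc 0 x))
    (hu : ∀ x, 0 < x → HasDerivAt u (v x) x) (hvpos : ∀ x, 0 < x → 0 < v x) {x : ℝ}
    (hx : 0 < x) : IntervalIntegrable v MeasureTheory.volume 0 x := by
  refine intervalIntegral.intervalIntegrable_deriv_of_nonneg (g := u)
    (by rw [uIcc_of_le hx.le]; exact huc x hx) (fun y hy => hu y ?_) fun y hy => (hvpos y ?_).le
  all_goals
    rw [min_eq_left hx.le] at hy
    exact hy.1

theorem integral_deriv_eq {u v : ℝ → ℝ} (huc : ∀ x, 0 < x → ContinuousOn u (Icc 0 x))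
    (hu0 : u 0 = 0) (hu : ∀ x, 0 < x → HasDerivAt u (v x) x) (hvpos : ∀ x, 0 < x → 0 < v x)
    {x : ℝ} (hx : 0 < x) : ∫ t in (0 : ℝ)..x, v t = u x := by
  rw [intervalIntegral.integral_eq_sub_of_hasDerivAt_of_le hx.le (huc x hx)
    (fun y hy => hu y hy.1) (intervalIntegrable_deriv huc hu hvpos hx), hu0, sub_zero]

theorem exp_mul_integral_le {v : ℝ → ℝ} {γ x : ℝ} (hγ : 0 ≤ γ) (hx : 0 < x)
    (hv : IntervalIntegrable v MeasureTheory.volume 0 x) (hvpos : ∀ x, 0 < x → 0 < v x) :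
    Real.exp (-γ * x) * ∫ t in (0 : ℝ)..x, v t ≤ ∫ t in (0 : ℝ)..x, Real.exp (-γ * t) * v t := by
  rw [← intervalIntegral.integral_const_mul]
  refine intervalIntegral.integral_mono_on_of_le_Ioo hx.le (hv.const_mul _)
    (intervalIntegrable_exp_mul γ hv) fun t ht => ?_
  refine mul_le_mul_of_nonneg_right (Real.exp_le_exp.2 ?_) (hvpos t ht.1).le
  nlinarith [ht.2]

theorem exp_mul_integral_lt {v : ℝ → ℝ} {γ x : ℝ} (hγ : 0 < γ) (hx : 0 < x)
    (hv : IntervalIntegrable v MeasureTheory.volume 0 x) (hvpos : ∀ x, 0 < x → 0 < v x) :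
    Real.exp (-γ * x) * ∫ t in (0 : ℝ)..x, v t < ∫ t in (0 : ℝ)..x, Real.exp (-γ * t) * v t := by
  rw [← intervalIntegral.integral_const_mul, ← sub_pos, ← intervalIntegral.integral_sub
    (intervalIntegrable_exp_mul γ hv) (hv.const_mul _)]
  refine intervalIntegral.intervalIntegral_pos_of_pos_on
    ((intervalIntegrable_exp_mul γ hv).sub (hv.const_mul _)) (fun t ht => ?_) hx
  rw [← sub_mul]
  refine mul_pos (sub_pos.2 (Real.exp_lt_exp.2 ?_)) (hvpos t ht.1)
  nlinarith [ht.2]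

theorem integral_exp_mul_le {v : ℝ → ℝ} {γ x : ℝ} (hγ : 0 ≤ γ) (hx : 0 < x)
    (hv : IntervalIntegrable v MeasureTheory.volume 0 x) (hvpos : ∀ x, 0 < x → 0 < v x) :
    ∫ t in (0 : ℝ)..x, Real.exp (-γ * t) * v t ≤ ∫ t in (0 : ℝ)..x, v t := by
  refine intervalIntegral.integral_mono_on_of_le_Ioo hx.le
    (intervalIntegrable_exp_mul γ hv) hv fun t ht => ?_
  refine mul_le_of_le_one_left (hvpos t ht.1).le (Real.exp_le_one_iff.2 ?_)
  nlinarith [ht.1]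

/-- If `0 < u < u'` then `(1 - γ) ∫ exp (-γ t) u'(t) dt < exp (-γ x) u(x)` for `γ > 0`: the
right-hand side is `∫ exp (-γ t) (u'(t) - γ u(t)) dt`. -/
theorem integral_exp_mul_deriv_lt {u v : ℝ → ℝ} (huc : ∀ x, 0 < x → ContinuousOn u (Icc 0 x))
    (hu0 : u 0 = 0) (hu : ∀ x, 0 < x → HasDerivAt u (v x) x) (hpos : ∀ x, 0 < x → 0 < u x)
    (hlt : ∀ x, 0 < x → u x < v x) {γ x : ℝ} (hγ : 0 < γ) (hx : 0 < x) :
    (1 - γ) * ∫ t in (0 : ℝ)..x, Real.exp (-γ * t) * v t < Real.exp (-γ * x) * u x := by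
  have hv := intervalIntegrable_deriv huc hu (fun y hy => (hpos y hy).trans (hlt y hy)) hx
  have hui : IntervalIntegrable u MeasureTheory.volume 0 x :=
    ContinuousOn.intervalIntegrable (by rw [uIcc_of_le hx.le]; exact huc x hx)
  have hev := intervalIntegrable_exp_mul γ hv
  have heu := intervalIntegrable_exp_mul γ hui
  have hftc : ∫ t in (0 : ℝ)..x, (Real.exp (-γ * t) * v t - γ * (Real.exp (-γ * t) * u t)) =
      Real.exp (-γ * x) * u x := by
    rw [intervalIntegral.integral_eq_sub_of_hasDerivAt_of_le
      (f := fun t => Real.exp (-γ * t) * u t) hx.le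
      (ContinuousOn.mul (by fun_prop) (huc x hx)) (fun t ht => ?_) (hev.sub (heu.const_mul γ)),
      hu0, mul_zero, sub_zero]
    refine ((((hasDerivAt_id t).const_mul (-γ)).exp).mul (hu t ht.1)).congr_deriv ?_
    simp only [id]
    ring
  rw [← hftc, ← sub_pos, ← intervalIntegral.integral_const_mul, ← intervalIntegral.integral_sub
    (hev.sub (heu.const_mul γ)) (hev.const_mul _)]
  refine intervalIntegral.intervalIntegral_pos_of_pos_on
    ((hev.sub (heu.const_mul γ)).sub (hev.const_mul _)) (fun t ht => ?_) hx
  have h : 0 < γ * Real.exp (-γ * t) * (v t - u t) :=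
    mul_pos (mul_pos hγ (Real.exp_pos _)) (sub_pos.2 (hlt t ht.1))
  linarith

theorem integral_exp_mul_deriv_le {u v : ℝ → ℝ} (huc : ∀ x, 0 < x → ContinuousOn u (Icc 0 x))
    (hu0 : u 0 = 0) (hu : ∀ x, 0 < x → HasDerivAt u (v x) x) (hpos : ∀ x, 0 < x → 0 < u x)
    (hlt : ∀ x, 0 < x → u x < v x) {γ x : ℝ} (hγ : 0 ≤ γ) (hx : 0 < x) :
    (1 - γ) * ∫ t in (0 : ℝ)..x, Real.exp (-γ * t) * v t ≤ Real.exp (-γ * x) * u x := by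
  rcases hγ.eq_or_lt with rfl | hγ
  · simp [integral_deriv_eq huc hu0 hu (fun y hy => (hpos y hy).trans (hlt y hy)) hx]
  · exact (integral_exp_mul_deriv_lt huc hu0 hu hpos hlt hγ hx).le

theorem mul_integral_exp_mul_deriv_eq_iff {u v : ℝ → ℝ}
    (huc : ∀ x, 0 < x → ContinuousOn u (Icc 0 x))
    (hu0 : u 0 = 0) (hu : ∀ x, 0 < x → HasDerivAt u (v x) x) (hpos : ∀ x, 0 < x → 0 < u x)
    (hlt : ∀ x, 0 < x → u x < v x) {γ x : ℝ} (hγ : 0 ≤ γ) (hx : 0 < x) :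
    (1 - γ) * ∫ t in (0 : ℝ)..x, Real.exp (-γ * t) * v t = Real.exp (-γ * x) * u x ↔ γ = 0 := by
  refine ⟨fun h => ?_, ?_⟩
  · by_contra h0
    exact (integral_exp_mul_deriv_lt huc hu0 hu hpos hlt (hγ.lt_of_ne' h0) hx).ne h
  · rintro rfl
    simp [integral_deriv_eq huc hu0 hu (fun y hy => (hpos y hy).trans (hlt y hy)) hx]

/-- Sharpness of `1 / (1 - γ)`: if `u' / u → 1` and `R / u → s`, then a bound
`∫ exp (-γ t) u'(t) dt ≤ C exp (-γ x) R(x)` forces `C s ≥ 1 / (1 - γ)`. For `c < 1 / (1 - γ)` the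
difference `∫ exp (-γ t) u'(t) dt - c exp (-γ x) u(x)` is eventually increasing, hence bounded
below, while `exp (-γ x) u(x) → ∞`. -/
theorem inv_le_of_integral_exp_mul_deriv_le {u v R : ℝ → ℝ}
    (huc : ∀ x, 0 < x → ContinuousOn u (Icc 0 x))
    (hu : ∀ x, 0 < x → HasDerivAt u (v x) x) (hvc : ∀ x, 0 < x → ContinuousAt v x)
    (hpos : ∀ x, 0 < x → 0 < u x)
    (hlt : ∀ x, 0 < x → u x < v x) (hvu : Tendsto (fun x => v x / u x) atTop (𝓝 1)) {s : ℝ}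
    (hR : Tendsto (fun x => R x / u x) atTop (𝓝 s)) {γ : ℝ} (hγ : γ < 1) {C : ℝ}
    (hC : ∀ x, 0 < x →
      ∫ t in (0 : ℝ)..x, Real.exp (-γ * t) * v t ≤ C * (Real.exp (-γ * x) * R x)) :
    1 / (1 - γ) ≤ C * s := by
  have hγ' : 0 < 1 - γ := sub_pos.2 hγ
  refine le_of_forall_lt fun c hc => ?_
  obtain ⟨c', hcc', hc'⟩ := exists_between hc
  refine hcc'.trans_le ?_
  have hvpos : ∀ x, 0 < x → 0 < v x := fun y hy => (hpos y hy).trans (hlt y hy)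
  set D : ℝ → ℝ := fun x => (∫ t in (0 : ℝ)..x, Real.exp (-γ * t) * v t) -
    c' * (Real.exp (-γ * x) * u x) with hD
  have hdI : ∀ x, 0 < x → HasDerivAt (fun x => ∫ t in (0 : ℝ)..x, Real.exp (-γ * t) * v t)
      (Real.exp (-γ * x) * v x) x := fun x hx => by
    have hcont : ∀ y ∈ Ioi (0 : ℝ), ContinuousAt (fun t => Real.exp (-γ * t) * v t) y :=
      fun y hy => ContinuousAt.mul (by fun_prop) (hvc y hy)
    refine intervalIntegral.integral_hasDerivAt_right
      (intervalIntegrable_exp_mul γ (intervalIntegrable_deriv huc hu hvpos hx)) ?_ (hcont x hx)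
    exact ContinuousAt.stronglyMeasurableAtFilter isOpen_Ioi hcont x hx
  have hdD : ∀ x, 0 < x → HasDerivAt D
      (Real.exp (-γ * x) * ((1 - c') * v x + c' * γ * u x)) x := fun x hx => by
    refine ((hdI x hx).sub (((((hasDerivAt_id x).const_mul (-γ)).exp).mul
      (hu x hx)).const_mul c')).congr_deriv ?_
    simp only [id]
    ring
  have hlim : Tendsto (fun x => (1 - c') * (v x / u x) + c' * γ) atTop
      (𝓝 ((1 - c') * 1 + c' * γ)) := (hvu.const_mul _).add_const _
  have hlimpos : 0 < (1 - c') * 1 + c' * γ := by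
    rw [lt_div_iff₀ hγ'] at hc'
    linarith
  obtain ⟨X, hX⟩ := eventually_atTop.1
    ((hlim.eventually_const_lt hlimpos).and (eventually_gt_atTop (0 : ℝ)))
  have hmono : MonotoneOn D (Ici X) := by
    refine monotoneOn_of_deriv_nonneg (convex_Ici X)
      (fun y hy => (hdD y (hX y hy).2).continuousAt.continuousWithinAt)
      (fun y hy => (hdD y (hX y (interior_subset hy)).2).differentiableAt.differentiableWithinAt)
      fun y hy => ?_
    obtain ⟨h1, h2⟩ := hX y (interior_subset hy)
    rw [(hdD y h2).deriv]
    have huy := hpos y h2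
    have e : (1 - c') * v y + c' * γ * u y = ((1 - c') * (v y / u y) + c' * γ) * u y := by
      field_simp
    rw [e]
    positivity
  have htop := tendsto_exp_mul_atTop hu hpos hlt hγ
  have hleft : Tendsto (fun x => c' + D X / (Real.exp (-γ * x) * u x)) atTop (𝓝 (c' + 0)) :=
    (htop.const_div_atTop (D X)).const_add c'
  rw [add_zero] at hleft
  refine le_of_tendsto_of_tendsto hleft (hR.const_mul C) ?_
  filter_upwards [eventually_ge_atTop X] with x hx
  have hx0 := (hX x hx).2
  have hux := hpos x hx0
  have h1 : D X ≤ D x := hmono (mem_Ici.2 le_rfl) hx hx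
  have h2 := hC x hx0
  have hex := Real.exp_pos (-γ * x)
  have e1 : c' + D X / (Real.exp (-γ * x) * u x) =
      (c' * (Real.exp (-γ * x) * u x) + D X) / (Real.exp (-γ * x) * u x) := by field_simp
  have e2 : C * (R x / u x) = C * (Real.exp (-γ * x) * R x) / (Real.exp (-γ * x) * u x) := by
    field_simp
  rw [e1, e2]
  refine div_le_div_of_nonneg_right ?_ (by positivity)
  simp only [hD] at h1 ⊢
  linarith

/-! ### Primitives and second derivatives of generalised power series -/

theorem EvenSummable.change {b : ℕ → ℝ} {α : ℝ} (h : EvenSummable b α) (β : ℝ) :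
    EvenSummable b β := fun x hx => by
  refine ((h x hx).mul_left (x ^ (β - α))).congr fun k => ?_
  rw [mul_left_comm, ← Real.rpow_add hx]
  ring_nf

/-- The coefficients of the termwise primitive of `evenSeries b α` that vanishes at `0`, a series
with leading exponent `α + 1`. -/
noncomputable def primCoeff (b : ℕ → ℝ) (α : ℝ) (k : ℕ) : ℝ := b k / (α + 1 + 2 * (k : ℝ))

theorem primCoeff_pos {b : ℕ → ℝ} {α : ℝ} (hα : 0 < α + 1) (hb : ∀ k, 0 < b k) (k : ℕ) :
    0 < primCoeff b α k :=
  div_pos (hb k) (by positivity)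

theorem EvenSummable.prim {b : ℕ → ℝ} {α : ℝ} (hα : 0 < α + 1) (hb : ∀ k, 0 < b k)
    (hs : EvenSummable b α) : EvenSummable (primCoeff b α) (α + 1) := fun x hx => by
  have hp : ∀ p : ℝ, 0 < x ^ p := fun p => Real.rpow_pos_of_pos hx p
  refine Summable.of_nonneg_of_le (fun k => (mul_pos (primCoeff_pos hα hb k) (hp _)).le)
    (fun k => ?_) ((hs.change (α + 1) x hx).mul_left (α + 1)⁻¹)
  rw [← mul_assoc]
  refine mul_le_mul_of_nonneg_right ?_ (hp _).le
  rw [primCoeff, div_eq_inv_mul]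
  refine mul_le_mul_of_nonneg_right (inv_anti₀ hα ?_) (hb k).le
  have : (0 : ℝ) ≤ k := k.cast_nonneg
  linarith

theorem derivCoeff_primCoeff {α : ℝ} (hα : 0 < α + 1) (b : ℕ → ℝ) :
    derivCoeff (primCoeff b α) (α + 1) = b := by
  funext k
  rw [derivCoeff, primCoeff]
  have : α + 1 + 2 * (k : ℝ) ≠ 0 := by positivity
  field_simp

theorem hasDerivAt_evenSeries_primCoeff {b : ℕ → ℝ} {α : ℝ} (hα : 0 < α + 1)
    (hb : ∀ k, 0 < b k) (hs : EvenSummable b α) {x : ℝ} (hx : 0 < x) :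
    HasDerivAt (evenSeries (primCoeff b α) (α + 1)) (evenSeries b α x) x := by
  have h := hasDerivAt_evenSeries hα.le (fun k => (primCoeff_pos hα hb k).le) (hs.prim hα hb) hx
  rwa [derivCoeff_primCoeff hα, add_sub_cancel_right] at h

theorem tendsto_affine_div_affine (p q : ℝ) :
    Tendsto (fun k : ℕ => (2 * (k : ℝ) + p) / (2 * (k : ℝ) + q)) atTop (𝓝 1) := by
  have h := tendsto_add_mul_div_add_mul_atTop_nhds p q (2 : ℝ) (two_ne_zero (α := ℝ))
  simpa [add_comm] using h

/-- A positive series `u` whose second derivative, apart from its lowest term, has coefficients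
`(2k + 2ν + 2) / (2k + 3)` times those of `u`, where `ν ≥ 1 / 2`. This factor is at least `1` and
tends to `1`, so that `u < u'` and `u' / u → 1` at infinity. -/
theorem evenSeries_lt_deriv_and_tendsto {b : ℕ → ℝ} {α ν : ℝ} (hα : 1 < α) (hν : 1 / 2 ≤ ν)
    (hb : ∀ k, 0 < b k) (hs : EvenSummable b α)
    (hrec : ∀ k : ℕ, derivCoeff (derivCoeff b α) (α - 1) (k + 1) =
      (2 * (k : ℝ) + (2 * ν + 2)) / (2 * (k : ℝ) + 3) * b k) :
    (∀ x, 0 < x → evenSeries b α x < evenSeries (derivCoeff b α) (α - 1) x) ∧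
    Tendsto (fun x => evenSeries (derivCoeff b α) (α - 1) x / evenSeries b α x) atTop (𝓝 1) := by
  have hα0 : 0 < α := by linarith
  have hα1 : 0 < α - 1 := by linarith
  have hb0 := fun k => (hb k).le
  have hd := derivCoeff_pos hα0 hb
  have hd0 := fun k => (hd k).le
  have hsd := hs.deriv hα0.le hb0
  have hdd := derivCoeff_pos hα1 hd
  have hsdd := hsd.deriv hα1.le hd0
  have hu := fun x (hx : 0 < x) => hasDerivAt_evenSeries hα0.le hb0 hs hx
  have hv := fun x (hx : 0 < x) => hasDerivAt_evenSeries hα1.le hd0 hsd hx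
  have hss := hs.shift
  rw [show α - 2 = α - 1 - 1 by ring] at hss
  have hshift : ∀ x, 0 < x → evenSeries (shiftCoeff b) (α - 1 - 1) x = evenSeries b α x :=
    fun x hx => by rw [← evenSeries_shift hs hx, show α - 2 = α - 1 - 1 by ring]
  have hlt : ∀ x, 0 < x → evenSeries b α x <
      evenSeries (derivCoeff (derivCoeff b α) (α - 1)) (α - 1 - 1) x := fun x hx => by
    rw [← hshift x hx]
    refine evenSeries_lt hss hsdd (fun k => ?_) (i := 0) (hdd 0) hx
    cases k with
    | zero => exact (hdd 0).le
    | succ k =>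
      rw [hrec k]
      refine le_mul_of_one_le_left (hb0 k) ((one_le_div (by positivity)).2 ?_)
      linarith
  have hlt' : ∀ x, 0 < x → evenSeries b α x < evenSeries (derivCoeff b α) (α - 1) x :=
    fun x hx => lt_deriv_of_lt_deriv_deriv
      (fun y hy => continuousOn_evenSeries hα0 hb0 hs hy)
      (fun y hy => continuousOn_evenSeries hα1 hd0 hsd hy) (evenSeries_zero hα0 b)
      (evenSeries_zero hα1 _) hu hv hlt hx
  refine ⟨hlt', tendsto_deriv_div hu hv (fun x hx => evenSeries_pos hb hs hx) hlt' ?_⟩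
  have hcoef : Tendsto (fun k => shiftCoeff b k / derivCoeff (derivCoeff b α) (α - 1) k) atTop
      (𝓝 1) := by
    rw [← tendsto_add_atTop_iff_nat 1]
    refine (tendsto_affine_div_affine 3 (2 * ν + 2)).congr fun k => ?_
    have hbk := (hb k).ne'
    have h2 : 2 * (k : ℝ) + (2 * ν + 2) ≠ 0 := by positivity
    rw [hrec k, shiftCoeff]
    field_simp
  have h := (tendsto_evenSeries_div hdd hsdd hss hcoef).inv₀ one_ne_zero
  rw [inv_one] at h
  refine h.congr' ?_
  filter_upwards [eventually_gt_atTop (0 : ℝ)] with x hx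
  rw [inv_div, hshift x hx]

/-! ### Coefficients of the Struve functions -/

/-- The coefficients of `struveL μ`, as a series with leading exponent `μ + 1`. -/
noncomputable def struveCoeff (μ : ℝ) (k : ℕ) : ℝ :=
  1 / (Real.Gamma ((k : ℝ) + 3 / 2) * Real.Gamma ((k : ℝ) + μ + 3 / 2) *
    2 ^ (μ + 2 * (k : ℝ) + 1))

theorem struveCoeff_pos {μ : ℝ} (hμ : -3 / 2 < μ) (k : ℕ) : 0 < struveCoeff μ k := by
  have h0 : (0 : ℝ) ≤ k := k.cast_nonneg
  have h1 := Real.Gamma_pos_of_pos (show (0 : ℝ) < (k : ℝ) + 3 / 2 by positivity)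
  have h2 := Real.Gamma_pos_of_pos (show (0 : ℝ) < (k : ℝ) + μ + 3 / 2 by linarith)
  rw [struveCoeff]
  positivity

theorem struveL_term_eq (μ : ℝ) {x : ℝ} (hx : 0 < x) (k : ℕ) :
    (x / 2) ^ (μ + 2 * (k : ℝ) + 1) /
      (Real.Gamma ((k : ℝ) + 3 / 2) * Real.Gamma ((k : ℝ) + μ + 3 / 2)) =
    struveCoeff μ k * x ^ (μ + 1 + 2 * (k : ℝ)) := by
  rw [struveCoeff, Real.div_rpow hx.le two_pos.le,
    show μ + 1 + 2 * (k : ℝ) = μ + 2 * (k : ℝ) + 1 by ring, div_div, one_div_mul_eq_div]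
  ring_nf

theorem evenSummable_struveCoeff (μ α : ℝ) : EvenSummable (struveCoeff μ) α :=
  EvenSummable.change (α := μ + 1)
    (fun _ hx => (summable_struveL μ hx).congr (struveL_term_eq μ hx)) α

theorem rpow_mul_struveL (ν μ : ℝ) {x : ℝ} (hx : 0 < x) :
    x ^ ν * struveL μ x = evenSeries (struveCoeff μ) (ν + μ + 1) x := by
  rw [struveL, evenSeries, ← tsum_mul_left]
  refine tsum_congr fun k => ?_
  rw [struveL_term_eq μ hx k, mul_left_comm, ← Real.rpow_add hx]
  ring_nf

theorem struveCoeff_eq_order {μ : ℝ} (hμ : -3 / 2 < μ) (k : ℕ) :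
    struveCoeff μ k = (2 * (k : ℝ) + (2 * μ + 3)) * struveCoeff (μ + 1) k := by
  have h0 : (0 : ℝ) ≤ k := k.cast_nonneg
  have hp : 0 < (k : ℝ) + μ + 3 / 2 := by linarith
  have h1 := (Real.Gamma_pos_of_pos (show (0 : ℝ) < (k : ℝ) + 3 / 2 by positivity)).ne'
  have h2 := (Real.Gamma_pos_of_pos hp).ne'
  rw [struveCoeff, struveCoeff, show (k : ℝ) + (μ + 1) + 3 / 2 = (k : ℝ) + μ + 3 / 2 + 1 by ring,
    Real.Gamma_add_one hp.ne', show μ + 1 + 2 * (k : ℝ) + 1 = μ + 2 * (k : ℝ) + 1 + 1 by ring,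
    Real.rpow_add_one two_ne_zero (μ + 2 * (k : ℝ) + 1),
    show 2 * (k : ℝ) + (2 * μ + 3) = ((k : ℝ) + μ + 3 / 2) * 2 by ring]
  have h3 : (2 : ℝ) ^ (μ + 2 * (k : ℝ) + 1) ≠ 0 := (Real.rpow_pos_of_pos two_pos _).ne'
  generalize (2 : ℝ) ^ (μ + 2 * (k : ℝ) + 1) = r at *
  generalize (k : ℝ) + μ + 3 / 2 = p at *
  have := hp.ne'
  field_simp

theorem struveCoeff_eq_succ {μ : ℝ} (hμ : -3 / 2 < μ) (k : ℕ) :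
    struveCoeff μ k =
      (2 * (k : ℝ) + 3) * (2 * (k : ℝ) + (2 * μ + 3)) * struveCoeff μ (k + 1) := by
  have h0 : (0 : ℝ) ≤ k := k.cast_nonneg
  have hq : 0 < (k : ℝ) + 3 / 2 := by linarith
  have hp : 0 < (k : ℝ) + μ + 3 / 2 := by linarith
  have h1 := (Real.Gamma_pos_of_pos hq).ne'
  have h2 := (Real.Gamma_pos_of_pos hp).ne'
  rw [struveCoeff, struveCoeff]
  push_cast
  rw [show (k : ℝ) + 1 + 3 / 2 = (k : ℝ) + 3 / 2 + 1 by ring,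
    show (k : ℝ) + 1 + μ + 3 / 2 = (k : ℝ) + μ + 3 / 2 + 1 by ring,
    Real.Gamma_add_one hp.ne', Real.Gamma_add_one hq.ne',
    show μ + 2 * ((k : ℝ) + 1) + 1 = μ + 2 * (k : ℝ) + 1 + 1 + 1 by ring,
    Real.rpow_add_one two_ne_zero (μ + 2 * (k : ℝ) + 1 + 1),
    Real.rpow_add_one two_ne_zero (μ + 2 * (k : ℝ) + 1),
    show 2 * (k : ℝ) + (2 * μ + 3) = ((k : ℝ) + μ + 3 / 2) * 2 by ring,
    show 2 * (k : ℝ) + 3 = ((k : ℝ) + 3 / 2) * 2 by ring]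
  have h3 : (2 : ℝ) ^ (μ + 2 * (k : ℝ) + 1) ≠ 0 := (Real.rpow_pos_of_pos two_pos _).ne'
  generalize (2 : ℝ) ^ (μ + 2 * (k : ℝ) + 1) = r at *
  generalize (k : ℝ) + μ + 3 / 2 = p at *
  generalize (k : ℝ) + 3 / 2 = q at *
  have := hp.ne'
  have := hq.ne'
  field_simp

/-! ### Primitives of `x ^ ν * struveL μ x` -/

/-- The function `x ^ ν * struveL μ x`. -/
noncomputable def powStruve (ν μ x : ℝ) : ℝ := x ^ ν * struveL μ x

/-- The primitive of `powStruve ν μ` that vanishes at `0`, for `-2 < ν + μ`. -/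
noncomputable def powStruvePrim (ν μ : ℝ) : ℝ → ℝ :=
  evenSeries (primCoeff (struveCoeff μ) (ν + μ + 1)) (ν + μ + 1 + 1)

theorem powStruve_eq (ν μ : ℝ) {x : ℝ} (hx : 0 < x) :
    powStruve ν μ x = evenSeries (struveCoeff μ) (ν + μ + 1) x :=
  rpow_mul_struveL ν μ hx

theorem powStruve_pos (ν : ℝ) {μ : ℝ} (hμ : -3 / 2 < μ) {x : ℝ} (hx : 0 < x) :
    0 < powStruve ν μ x := by
  rw [powStruve_eq ν μ hx]
  exact evenSeries_pos (struveCoeff_pos hμ) (evenSummable_struveCoeff μ _) hx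

theorem continuousAt_powStruve {ν μ : ℝ} (hμ : -3 / 2 < μ) (hνμ : 0 ≤ ν + μ + 1) {x : ℝ}
    (hx : 0 < x) : ContinuousAt (powStruve ν μ) x := by
  have h := hasDerivAt_evenSeries hνμ (fun k => (struveCoeff_pos hμ k).le)
    (evenSummable_struveCoeff μ (ν + μ + 1)) hx
  refine h.continuousAt.congr ?_
  filter_upwards [Ioi_mem_nhds hx] with y hy
  exact (powStruve_eq ν μ hy).symm

theorem powStruvePrim_zero {ν μ : ℝ} (hνμ : 0 < ν + μ + 1 + 1) : powStruvePrim ν μ 0 = 0 :=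
  evenSeries_zero hνμ _

theorem powStruvePrim_pos {ν μ : ℝ} (hμ : -3 / 2 < μ) (hνμ : 0 < ν + μ + 1 + 1) {x : ℝ}
    (hx : 0 < x) : 0 < powStruvePrim ν μ x :=
  evenSeries_pos (primCoeff_pos hνμ (struveCoeff_pos hμ))
    ((evenSummable_struveCoeff μ _).prim hνμ (struveCoeff_pos hμ)) hx

theorem continuousOn_powStruvePrim {ν μ : ℝ} (hμ : -3 / 2 < μ) (hνμ : 0 < ν + μ + 1 + 1) {x : ℝ}
    (hx : 0 < x) : ContinuousOn (powStruvePrim ν μ) (Icc 0 x) :=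
  continuousOn_evenSeries hνμ (fun k => (primCoeff_pos hνμ (struveCoeff_pos hμ) k).le)
    ((evenSummable_struveCoeff μ _).prim hνμ (struveCoeff_pos hμ)) hx

theorem hasDerivAt_powStruvePrim {ν μ : ℝ} (hμ : -3 / 2 < μ) (hνμ : 0 < ν + μ + 1 + 1) {x : ℝ}
    (hx : 0 < x) : HasDerivAt (powStruvePrim ν μ) (powStruve ν μ x) x := by
  rw [powStruve_eq ν μ hx]
  exact hasDerivAt_evenSeries_primCoeff hνμ (struveCoeff_pos hμ) (evenSummable_struveCoeff μ _) hx

theorem intervalIntegrable_powStruve {ν μ : ℝ} (hμ : -3 / 2 < μ) (hνμ : 0 < ν + μ + 1 + 1)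
    {x : ℝ} (hx : 0 < x) : IntervalIntegrable (powStruve ν μ) MeasureTheory.volume 0 x :=
  intervalIntegrable_deriv (fun _ hy => continuousOn_powStruvePrim hμ hνμ hy)
    (fun _ hy => hasDerivAt_powStruvePrim hμ hνμ hy) (fun _ hy => powStruve_pos ν hμ hy) hx

theorem integral_powStruve {ν μ : ℝ} (hμ : -3 / 2 < μ) (hνμ : 0 < ν + μ + 1 + 1)
    {x : ℝ} (hx : 0 < x) : ∫ t in (0 : ℝ)..x, powStruve ν μ t = powStruvePrim ν μ x :=
  integral_deriv_eq (fun _ hy => continuousOn_powStruvePrim hμ hνμ hy) (powStruvePrim_zero hνμ)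
    (fun _ hy => hasDerivAt_powStruvePrim hμ hνμ hy) (fun _ hy => powStruve_pos ν hμ hy) hx

theorem primCoeff_struveCoeff {μ : ℝ} (hμ : -3 / 2 < μ) (α : ℝ) (k : ℕ) :
    primCoeff (struveCoeff μ) α k =
      (2 * (k : ℝ) + (2 * μ + 3)) / (2 * (k : ℝ) + (α + 1)) * struveCoeff (μ + 1) k := by
  rw [primCoeff, struveCoeff_eq_order hμ, add_comm (α + 1)]
  ring

/-- The integrated form of the classical formula `(x ^ (ν + 1) L_{ν+1}(x))' = x ^ (ν + 1) L_ν(x)`. -/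
theorem powStruvePrim_add_one {ν : ℝ} (hν : -3 / 2 < ν) {x : ℝ} (hx : 0 < x) :
    powStruvePrim (ν + 1) ν x = powStruve (ν + 1) (ν + 1) x := by
  have h : primCoeff (struveCoeff ν) (ν + 1 + ν + 1) = struveCoeff (ν + 1) := by
    funext k
    have h0 : (0 : ℝ) ≤ k := k.cast_nonneg
    have h1 : 2 * (k : ℝ) + (2 * ν + 3) ≠ 0 := by linarith
    rw [primCoeff_struveCoeff hν, show ν + 1 + ν + 1 + 1 = 2 * ν + 3 by ring, div_self h1, one_mul]
  rw [powStruve_eq _ _ hx, powStruvePrim, h, show ν + 1 + ν + 1 + 1 = ν + 1 + (ν + 1) + 1 by ring]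

theorem powStruve_lt_powStruvePrim {n ν : ℝ} (hn : -1 < n) (hν : -(n + 2) / 2 < ν) {x : ℝ}
    (hx : 0 < x) : powStruve ν (ν + n + 1) x < powStruvePrim ν (ν + n) x := by
  have hμ : -3 / 2 < ν + n := by linarith
  have hα : 0 < ν + (ν + n) + 1 + 1 := by linarith
  have hlt : ∀ k, struveCoeff (ν + n + 1) k <
      primCoeff (struveCoeff (ν + n)) (ν + (ν + n) + 1) k := fun k => by
    have h0 : (0 : ℝ) ≤ k := k.cast_nonneg
    rw [primCoeff_struveCoeff hμ]
    refine lt_mul_of_one_lt_left (struveCoeff_pos (by linarith) k) ?_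
    rw [one_lt_div (by positivity)]
    linarith
  rw [powStruve_eq _ _ hx, powStruvePrim, show ν + (ν + n + 1) + 1 = ν + (ν + n) + 1 + 1 by ring]
  exact evenSeries_lt (evenSummable_struveCoeff _ _)
    ((evenSummable_struveCoeff _ _).prim hα (struveCoeff_pos hμ)) (fun k => (hlt k).le) (hlt 0) hx

theorem tendsto_powStruvePrim_div {n ν : ℝ} (hn : -1 < n) (hν : -(n + 2) / 2 < ν) :
    Tendsto (fun x => powStruvePrim ν (ν + n) x / powStruve ν (ν + n + 1) x) atTop (𝓝 1) := by
  have hμ : -3 / 2 < ν + n := by linarith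
  have hμ' : -3 / 2 < ν + n + 1 := by linarith
  have hα : 0 < ν + (ν + n) + 1 + 1 := by linarith
  have h := tendsto_evenSeries_div (α := ν + (ν + n) + 1 + 1) (l := 1)
    (struveCoeff_pos hμ') (evenSummable_struveCoeff _ _)
    ((evenSummable_struveCoeff (ν + n) _).prim hα (struveCoeff_pos hμ)) ?_
  · refine h.congr' ?_
    filter_upwards [eventually_gt_atTop (0 : ℝ)] with x hx
    rw [powStruve_eq _ _ hx, powStruvePrim, show ν + (ν + n + 1) + 1 = ν + (ν + n) + 1 + 1 by ring]
  · refine (tendsto_affine_div_affine (2 * (ν + n) + 3) (ν + (ν + n) + 1 + 1)).congr fun k => ?_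
    rw [primCoeff_struveCoeff hμ, mul_div_cancel_right₀ _ (struveCoeff_pos hμ' k).ne']

theorem powStruvePrim_lt_and_tendsto {ν : ℝ} (hν : 1 / 2 ≤ ν) :
    (∀ x, 0 < x → powStruvePrim ν ν x < powStruve ν ν x) ∧
    Tendsto (fun x => powStruve ν ν x / powStruvePrim ν ν x) atTop (𝓝 1) := by
  have hμ : -3 / 2 < ν := by linarith
  have hα : 0 < ν + ν + 1 + 1 := by linarith
  obtain ⟨h1, h2⟩ := evenSeries_lt_deriv_and_tendsto (α := ν + ν + 1 + 1) (by linarith) hν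
    (primCoeff_pos hα (struveCoeff_pos hμ))
    ((evenSummable_struveCoeff ν _).prim hα (struveCoeff_pos hμ)) fun k => by
      have h0 : (0 : ℝ) ≤ k := k.cast_nonneg
      have h1 : ν + ν + 1 + 1 + 2 * (k : ℝ) ≠ 0 := by positivity
      have h2 : 2 * (k : ℝ) + 3 ≠ 0 := by positivity
      rw [derivCoeff_primCoeff hα, derivCoeff, primCoeff, struveCoeff_eq_succ hμ k]
      push_cast
      field_simp
      ring
  rw [derivCoeff_primCoeff hα, add_sub_cancel_right] at h1 h2
  refine ⟨fun x hx => (h1 x hx).trans_eq (powStruve_eq _ _ hx).symm, h2.congr' ?_⟩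
  filter_upwards [eventually_gt_atTop (0 : ℝ)] with x hx
  rw [powStruve_eq _ _ hx, powStruvePrim]

theorem powStruvePrim_add_one_lt_and_tendsto {ν : ℝ} (hν : -1 / 2 < ν) :
    (∀ x, 0 < x → powStruvePrim (ν + 1) ν x < powStruve (ν + 1) ν x) ∧
    Tendsto (fun x => powStruve (ν + 1) ν x / powStruvePrim (ν + 1) ν x) atTop (𝓝 1) := by
  have hμ : -3 / 2 < ν := by linarith
  have hα : 0 < ν + 1 + ν + 1 + 1 := by linarith
  obtain ⟨h1, h2⟩ := evenSeries_lt_deriv_and_tendsto (α := ν + 1 + ν + 1 + 1) (ν := ν + 1)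
    (by linarith) (by linarith)
    (primCoeff_pos hα (struveCoeff_pos hμ))
    ((evenSummable_struveCoeff ν _).prim hα (struveCoeff_pos hμ)) fun k => by
      have h0 : (0 : ℝ) ≤ k := k.cast_nonneg
      have h1 : ν + 1 + ν + 1 + 1 + 2 * (k : ℝ) ≠ 0 := by positivity
      have h2 : 2 * (k : ℝ) + 3 ≠ 0 := by positivity
      rw [derivCoeff_primCoeff hα, derivCoeff, primCoeff, struveCoeff_eq_succ hμ k]
      push_cast
      field_simp
      ring
  rw [derivCoeff_primCoeff hα, add_sub_cancel_right] at h1 h2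
  refine ⟨fun x hx => (h1 x hx).trans_eq (powStruve_eq _ _ hx).symm, h2.congr' ?_⟩
  filter_upwards [eventually_gt_atTop (0 : ℝ)] with x hx
  rw [powStruve_eq _ _ hx, powStruvePrim]

/-! ### The three-term majorant of the undamped integral -/

/-- `x ^ ν` times the bracket `2 (ν+n+1) L_{ν+n+1} - (n+1) L_{ν+n+3} - …` which bounds
`(2ν + n + 1) ∫₀ˣ t ^ ν L_{ν+n}(t) dt` from above. -/
noncomputable def struveMajorant (n ν x : ℝ) : ℝ :=
  x ^ ν * (2 * (ν + n + 1) * struveL (ν + n + 1) x - (n + 1) * struveL (ν + n + 3) x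
    - (n + 1) * x ^ (ν + n + 2) /
      (√Real.pi * 2 ^ (ν + n + 1) * (2 * ν + n + 2) * Real.Gamma (ν + n + 5 / 2)))

/-- The coefficients of `struveMajorant n ν`, with leading exponent `2ν + n + 2`. The last term of
the majorant only enters the coefficient at `0`. -/
noncomputable def majorantCoeff (n ν : ℝ) (k : ℕ) : ℝ :=
  2 * (ν + n + 1) * struveCoeff (ν + n + 1) k - (n + 1) * shiftCoeff (struveCoeff (ν + n + 3)) k
    - if k = 0 then (n + 1) / (2 * ν + n + 2) * struveCoeff (ν + n + 1) 0 else 0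

theorem hasSum_struveMajorant (n ν : ℝ) {x : ℝ} (hx : 0 < x) :
    HasSum (fun k : ℕ => majorantCoeff n ν k * x ^ (ν + (ν + n) + 1 + 1 + 2 * (k : ℝ)))
      (struveMajorant n ν x) := by
  have h1 := (evenSummable_struveCoeff (ν + n + 1) (ν + (ν + n) + 1 + 1) x hx).hasSum
  have hs := evenSummable_struveCoeff (ν + n + 3) (ν + (ν + n + 3) + 1)
  have h2 := (hs.shift x hx).hasSum
  have h3 := hasSum_ite_eq (0 : ℕ) ((n + 1) / (2 * ν + n + 2) * struveCoeff (ν + n + 1) 0 *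
    x ^ (ν + (ν + n) + 1 + 1))
  have e2 := evenSeries_shift hs hx
  rw [← rpow_mul_struveL ν (ν + n + 3) hx] at e2
  have e1 := rpow_mul_struveL ν (ν + n + 1) hx
  rw [show ν + (ν + n + 1) + 1 = ν + (ν + n) + 1 + 1 by ring] at e1
  rw [← evenSeries, ← e1] at h1
  rw [← evenSeries, e2, show ν + (ν + n + 3) + 1 - 2 = ν + (ν + n) + 1 + 1 by ring] at h2
  have h := ((h1.mul_left (2 * (ν + n + 1))).sub (h2.mul_left (n + 1))).sub h3
  have hval : struveMajorant n ν x = 2 * (ν + n + 1) * (x ^ ν * struveL (ν + n + 1) x) -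
      (n + 1) * (x ^ ν * struveL (ν + n + 3) x) -
      (n + 1) / (2 * ν + n + 2) * struveCoeff (ν + n + 1) 0 * x ^ (ν + (ν + n) + 1 + 1) := by
    have e3 : √Real.pi = Real.Gamma (3 / 2) * 2 := by
      rw [show (3 / 2 : ℝ) = 1 / 2 + 1 by norm_num, Real.Gamma_add_one (by norm_num),
        Real.Gamma_one_half_eq]
      ring
    have e4 : x ^ (ν + (ν + n) + 1 + 1) = x ^ ν * x ^ (ν + n + 2) := by
      rw [← Real.rpow_add hx]; ring_nf
    have e5 : struveCoeff (ν + n + 1) 0 =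
        1 / (√Real.pi * 2 ^ (ν + n + 1) * Real.Gamma (ν + n + 5 / 2)) := by
      rw [struveCoeff, e3]
      simp only [Nat.cast_zero, zero_add, mul_zero, add_zero]
      rw [Real.rpow_add_one two_ne_zero, show ν + n + 1 + 3 / 2 = ν + n + 5 / 2 by ring]
      ring_nf
    rw [struveMajorant, e4, e5]
    simp only [div_eq_mul_inv, mul_inv, one_mul]
    ring
  rw [hval]
  refine (congrArg (HasSum · _) (funext fun k => ?_)).mpr h
  rw [majorantCoeff]
  split_ifs with hk
  · rw [hk, Nat.cast_zero, mul_zero, add_zero]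
    ring
  · ring

/-- At the leading exponent the majorant and the integral it bounds agree; the last term of the
majorant is chosen for this. -/
theorem majorantCoeff_zero {n ν : ℝ} (hn : -1 < n) (hν : -(n + 1) / 2 < ν) :
    (2 * ν + n + 1) * primCoeff (struveCoeff (ν + n)) (ν + (ν + n) + 1) 0 =
      majorantCoeff n ν 0 := by
  have h1 : 2 * ν + n + 2 ≠ 0 := by linarith
  rw [primCoeff_struveCoeff (by linarith), majorantCoeff, if_pos rfl, shiftCoeff]
  rw [Nat.cast_zero, show 2 * (0 : ℝ) + (ν + (ν + n) + 1 + 1) = 2 * ν + n + 2 by ring]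
  field_simp
  ring

theorem majorantCoeff_succ {n ν : ℝ} (hn : -1 < n) (hν : -(n + 1) / 2 < ν) (k : ℕ) :
    majorantCoeff n ν (k + 1) = (2 * (ν + n + 1) - (n + 1) * ((2 * (k : ℝ) + 3) /
      (2 * (k : ℝ) + (2 * (ν + n) + 7)))) * struveCoeff (ν + n + 1) (k + 1) := by
  have h0 : (0 : ℝ) ≤ k := k.cast_nonneg
  have e1 := struveCoeff_eq_succ (μ := ν + n + 1) (by linarith) k
  have e2 := struveCoeff_eq_order (μ := ν + n + 1) (by linarith) k
  have e3 := struveCoeff_eq_order (μ := ν + n + 1 + 1) (by linarith) k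
  rw [e2, e3, show ν + n + 1 + 1 + 1 = ν + n + 3 by ring] at e1
  have h1 : 2 * (k : ℝ) + (2 * (ν + n + 1) + 3) ≠ 0 := by linarith
  have h2 : 2 * (k : ℝ) + (2 * (ν + n) + 7) ≠ 0 := by linarith
  have e4 : struveCoeff (ν + n + 3) k = (2 * (k : ℝ) + 3) / (2 * (k : ℝ) + (2 * (ν + n) + 7)) *
      struveCoeff (ν + n + 1) (k + 1) := by
    rw [div_mul_eq_mul_div, eq_div_iff h2]
    refine mul_left_cancel₀ h1 ?_
    linear_combination e1
  rw [majorantCoeff, if_neg (Nat.succ_ne_zero k), shiftCoeff, e4]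
  ring

theorem lt_majorantCoeff_succ {n ν : ℝ} (hn : -1 < n) (hν : -(n + 1) / 2 < ν) (k : ℕ) :
    (2 * ν + n + 1) * primCoeff (struveCoeff (ν + n)) (ν + (ν + n) + 1) (k + 1) <
      majorantCoeff n ν (k + 1) := by
  have h0 : (0 : ℝ) ≤ k := k.cast_nonneg
  rw [primCoeff_struveCoeff (by linarith), majorantCoeff_succ hn hν, ← mul_assoc]
  refine mul_lt_mul_of_pos_right ?_ (struveCoeff_pos (by linarith) _)
  push_cast
  have h1 : 0 < 2 * ((k : ℝ) + 1) + (ν + (ν + n) + 1 + 1) := by linarith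
  have h2 : 0 < 2 * (k : ℝ) + (2 * (ν + n) + 7) := by linarith
  have key : 2 * (ν + n + 1) - (n + 1) * ((2 * (k : ℝ) + 3) / (2 * (k : ℝ) + (2 * (ν + n) + 7))) -
      (2 * ν + n + 1) * ((2 * ((k : ℝ) + 1) + (2 * (ν + n) + 3)) /
        (2 * ((k : ℝ) + 1) + (ν + (ν + n) + 1 + 1))) =
      (n + 1) * (n + 3) * (2 * k + 3) / ((2 * ((k : ℝ) + 1) + (ν + (ν + n) + 1 + 1)) *
        (2 * (k : ℝ) + (2 * (ν + n) + 7))) := by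
    have h1' := h1.ne'
    have h2' := h2.ne'
    field_simp
    ring
  rw [← sub_pos, key]
  have : 0 < n + 1 := by linarith
  have : 0 < n + 3 := by linarith
  positivity

theorem mul_powStruvePrim_lt_struveMajorant {n ν : ℝ} (hn : -1 < n) (hν : -(n + 1) / 2 < ν)
    {x : ℝ} (hx : 0 < x) :
    (2 * ν + n + 1) * powStruvePrim ν (ν + n) x < struveMajorant n ν x := by
  have hμ : -3 / 2 < ν + n := by linarith
  have hα : 0 < ν + (ν + n) + 1 + 1 := by linarith
  have h1 := ((((evenSummable_struveCoeff _ _).prim hα (struveCoeff_pos hμ)) x hx).hasSum).mul_left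
    (2 * ν + n + 1)
  refine hasSum_lt (i := 1) (fun k => ?_) ?_ h1 (hasSum_struveMajorant n ν hx)
  · simp only
    rw [← mul_assoc]
    refine mul_le_mul_of_nonneg_right ?_ (Real.rpow_pos_of_pos hx _).le
    cases k with
    | zero => exact (majorantCoeff_zero hn hν).le
    | succ k => exact (lt_majorantCoeff_succ hn hν k).le
  · rw [← mul_assoc]
    exact mul_lt_mul_of_pos_right (lt_majorantCoeff_succ hn hν 0) (Real.rpow_pos_of_pos hx _)

theorem tendsto_struveMajorant_div {n ν : ℝ} (hn : -1 < n) (hν : -(n + 1) / 2 < ν) :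
    Tendsto (fun x => struveMajorant n ν x / powStruvePrim ν (ν + n) x) atTop
      (𝓝 (2 * ν + n + 1)) := by
  have hμ : -3 / 2 < ν + n := by linarith
  have hα : 0 < ν + (ν + n) + 1 + 1 := by linarith
  have h := tendsto_evenSeries_div (c := majorantCoeff n ν) (l := 2 * ν + n + 1)
    (primCoeff_pos hα (struveCoeff_pos hμ))
    ((evenSummable_struveCoeff _ _).prim hα (struveCoeff_pos hμ))
    (fun x hx => (hasSum_struveMajorant n ν hx).summable) ?_
  · refine h.congr' ?_
    filter_upwards [eventually_gt_atTop (0 : ℝ)] with x hx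
    rw [powStruvePrim, evenSeries, (hasSum_struveMajorant n ν hx).tsum_eq]
  · rw [← tendsto_add_atTop_iff_nat 1]
    have h1 := (((tendsto_affine_div_affine 3 (2 * (ν + n) + 7)).const_mul (n + 1)).const_sub
      (2 * (ν + n + 1))).mul (tendsto_affine_div_affine (ν + (ν + n) + 4) (2 * (ν + n) + 5))
    rw [show (2 * (ν + n + 1) - (n + 1) * 1) * 1 = 2 * ν + n + 1 by ring] at h1
    refine h1.congr fun k => ?_
    have h0 : (0 : ℝ) ≤ k := k.cast_nonneg
    have hc := (struveCoeff_pos (μ := ν + n + 1) (by linarith) (k + 1)).ne'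
    rw [primCoeff_struveCoeff hμ, majorantCoeff_succ hn hν, mul_div_mul_right _ _ hc]
    push_cast
    rw [div_div_eq_mul_div, mul_div_assoc]
    ring_nf

/-! ### The inequalities and their sharpness -/

theorem exp_mul_rpow_mul_struveL (γ ν μ t : ℝ) :
    Real.exp (-γ * t) * t ^ ν * struveL μ t = Real.exp (-γ * t) * powStruve ν μ t :=
  mul_assoc _ _ _

theorem damped_integral_lower_bound {n ν γ : ℝ} (hn : -1 < n) (hγ : 0 ≤ γ)
    (hν : -(n + 2) / 2 < ν) :
    (∀ x : ℝ, 0 < x → Real.exp (-γ * x) * powStruve ν (ν + n + 1) x <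
      ∫ t in (0 : ℝ)..x, Real.exp (-γ * t) * powStruve ν (ν + n) t) ∧
    (γ = 0 → ∀ C : ℝ,
      (∀ x : ℝ, 0 < x → C * (Real.exp (-γ * x) * powStruve ν (ν + n + 1) x) ≤
        ∫ t in (0 : ℝ)..x, Real.exp (-γ * t) * powStruve ν (ν + n) t) → C ≤ 1) := by
  have hμ : -3 / 2 < ν + n := by linarith
  have hα : 0 < ν + (ν + n) + 1 + 1 := by linarith
  refine ⟨fun x hx => ?_, ?_⟩
  · refine lt_of_lt_of_le ?_ (exp_mul_integral_le hγ hx (intervalIntegrable_powStruve hμ hα hx)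
      fun _ hy => powStruve_pos ν hμ hy)
    rw [integral_powStruve hμ hα hx]
    exact mul_lt_mul_of_pos_left (powStruve_lt_powStruvePrim hn hν hx) (Real.exp_pos _)
  · rintro rfl C hC
    refine ge_of_tendsto (tendsto_powStruvePrim_div hn hν) ?_
    filter_upwards [eventually_gt_atTop (0 : ℝ)] with x hx
    have h := hC x hx
    simp only [neg_zero, zero_mul, Real.exp_zero, one_mul] at h
    rw [integral_powStruve hμ hα hx] at h
    rwa [le_div_iff₀ (powStruve_pos ν (by linarith) hx)]

theorem integral_lt_and_sharp {ν : ℝ} (hν : 1 / 2 ≤ ν) :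
    (∀ x : ℝ, 0 < x → ∫ t in (0 : ℝ)..x, powStruve ν ν t < powStruve ν ν x) ∧
    (∀ C : ℝ, (∀ x : ℝ, 0 < x →
      ∫ t in (0 : ℝ)..x, powStruve ν ν t ≤ C * powStruve ν ν x) → 1 ≤ C) := by
  have hμ : -3 / 2 < ν := by linarith
  have hα : 0 < ν + ν + 1 + 1 := by linarith
  obtain ⟨h1, h2⟩ := powStruvePrim_lt_and_tendsto hν
  refine ⟨fun x hx => (integral_powStruve hμ hα hx).trans_lt (h1 x hx), fun C hC => ?_⟩
  have h3 := h2.const_mul C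
  rw [mul_one] at h3
  refine ge_of_tendsto h3 ?_
  filter_upwards [eventually_gt_atTop (0 : ℝ)] with x hx
  have h := hC x hx
  rw [integral_powStruve hμ hα hx] at h
  rwa [← mul_div_assoc, one_le_div (powStruvePrim_pos hμ hα hx)]

theorem integral_lt_majorant_and_sharp {n ν : ℝ} (hn : -1 < n) (hν : -(n + 1) / 2 < ν) :
    (∀ x : ℝ, 0 < x → ∫ t in (0 : ℝ)..x, powStruve ν (ν + n) t <
      1 / (2 * ν + n + 1) * struveMajorant n ν x) ∧
    (∀ C : ℝ, (∀ x : ℝ, 0 < x →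
      ∫ t in (0 : ℝ)..x, powStruve ν (ν + n) t ≤ C * struveMajorant n ν x) →
      1 / (2 * ν + n + 1) ≤ C) := by
  have hμ : -3 / 2 < ν + n := by linarith
  have hα : 0 < ν + (ν + n) + 1 + 1 := by linarith
  have hs : 0 < 2 * ν + n + 1 := by linarith
  refine ⟨fun x hx => ?_, fun C hC => ?_⟩
  · rw [integral_powStruve hμ hα hx, one_div_mul_eq_div, lt_div_iff₀ hs, mul_comm]
    exact mul_powStruvePrim_lt_struveMajorant hn hν hx
  · rw [div_le_iff₀ hs]
    refine ge_of_tendsto ((tendsto_struveMajorant_div hn hν).const_mul C) ?_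
    filter_upwards [eventually_gt_atTop (0 : ℝ)] with x hx
    have h := hC x hx
    rw [integral_powStruve hμ hα hx] at h
    rwa [← mul_div_assoc, one_le_div (powStruvePrim_pos hμ hα hx)]

/-- Whenever the primitive `u` of `v = powStruve ν μ` satisfies `u < v` and `v / u → 1`, the damped
integral of `v` is at most `exp (-γ x) u(x) / (1 - γ)`, with equality only for `γ = 0`, and the
constant is optimal even with `u` replaced by a function `R` asymptotic to `s u`. -/
theorem damped_integral_upper_bound {ν μ : ℝ} (hμ : -3 / 2 < μ) (hα : 0 ≤ ν + μ + 1)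
    (hlt : ∀ x, 0 < x → powStruvePrim ν μ x < powStruve ν μ x)
    (hlim : Tendsto (fun x => powStruve ν μ x / powStruvePrim ν μ x) atTop (𝓝 1))
    {γ : ℝ} (hγ : 0 ≤ γ) (hγ1 : γ < 1) :
    (∀ x : ℝ, 0 < x → ∫ t in (0 : ℝ)..x, Real.exp (-γ * t) * powStruve ν μ t ≤
      1 / (1 - γ) * (Real.exp (-γ * x) * powStruvePrim ν μ x)) ∧
    (∀ x : ℝ, 0 < x → (∫ t in (0 : ℝ)..x, Real.exp (-γ * t) * powStruve ν μ t =
      1 / (1 - γ) * (Real.exp (-γ * x) * powStruvePrim ν μ x) ↔ γ = 0)) ∧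
    (∀ (R : ℝ → ℝ) (s : ℝ), 0 < s →
      Tendsto (fun x => R x / powStruvePrim ν μ x) atTop (𝓝 s) → ∀ C : ℝ,
      (∀ x : ℝ, 0 < x → ∫ t in (0 : ℝ)..x, Real.exp (-γ * t) * powStruve ν μ t ≤
        C * (Real.exp (-γ * x) * R x)) → 1 / (s * (1 - γ)) ≤ C) := by
  have hα' : 0 < ν + μ + 1 + 1 := by linarith
  have hγ' : 0 < 1 - γ := sub_pos.2 hγ1
  have huc := fun x (hx : 0 < x) => continuousOn_powStruvePrim hμ hα' hx
  have hu := fun x (hx : 0 < x) => hasDerivAt_powStruvePrim hμ hα' hx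
  have hpos := fun x (hx : 0 < x) => powStruvePrim_pos hμ hα' hx
  have hu0 := powStruvePrim_zero hα'
  refine ⟨fun x hx => ?_, fun x hx => ?_, fun R s hs hR C hC => ?_⟩
  · rw [one_div_mul_eq_div, le_div_iff₀ hγ', mul_comm]
    exact integral_exp_mul_deriv_le huc hu0 hu hpos hlt hγ hx
  · rw [one_div_mul_eq_div, eq_div_iff hγ'.ne', mul_comm]
    exact mul_integral_exp_mul_deriv_eq_iff huc hu0 hu hpos hlt hγ hx
  · have h := inv_le_of_integral_exp_mul_deriv_le huc hu
      (fun x hx => continuousAt_powStruve hμ hα hx) hpos hlt hlim hR hγ1 hC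
    rw [div_le_iff₀ (mul_pos hs hγ')]
    rw [div_le_iff₀ hγ'] at h
    linarith

theorem damped_integral_order_lower_bound {ν γ : ℝ} (hγ : 0 ≤ γ) (hν : -3 / 2 < ν) :
    (∀ x : ℝ, 0 < x → Real.exp (-γ * x) * powStruve (ν + 1) (ν + 1) x ≤
      ∫ t in (0 : ℝ)..x, Real.exp (-γ * t) * powStruve (ν + 1) ν t) ∧
    (∀ x : ℝ, 0 < x → (∫ t in (0 : ℝ)..x, Real.exp (-γ * t) * powStruve (ν + 1) ν t =
      Real.exp (-γ * x) * powStruve (ν + 1) (ν + 1) x ↔ γ = 0)) ∧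
    (∀ C : ℝ, (∀ x : ℝ, 0 < x → C * (Real.exp (-γ * x) * powStruve (ν + 1) (ν + 1) x) ≤
      ∫ t in (0 : ℝ)..x, Real.exp (-γ * t) * powStruve (ν + 1) ν t) → C ≤ 1) := by
  have hα : 0 < ν + 1 + ν + 1 + 1 := by linarith
  have hint := fun x (hx : 0 < x) => intervalIntegrable_powStruve hν hα hx
  have hpos : ∀ x : ℝ, 0 < x → 0 < powStruve (ν + 1) ν x :=
    fun x hx => powStruve_pos (ν + 1) hν hx
  have hI : ∀ x : ℝ, 0 < x →
      ∫ t in (0 : ℝ)..x, powStruve (ν + 1) ν t = powStruve (ν + 1) (ν + 1) x := fun x hx => by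
    rw [integral_powStruve hν hα hx, powStruvePrim_add_one hν hx]
  refine ⟨fun x hx => ?_, fun x hx => ⟨fun h => ?_, ?_⟩, fun C hC => ?_⟩
  · rw [← hI x hx]
    exact exp_mul_integral_le hγ hx (hint x hx) hpos
  · by_contra h0
    rw [← hI x hx] at h
    exact (exp_mul_integral_lt (hγ.lt_of_ne' h0) hx (hint x hx) hpos).ne' h
  · rintro rfl
    simp [hI x hx]
  -- As `x → 0` both damping factors tend to `1`, so small arguments already decide the constant.
  · have hlim : Tendsto (fun x => C * Real.exp (-γ * x)) (𝓝[>] 0) (𝓝 (C * Real.exp (-γ * 0))) :=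
      ((by fun_prop : Continuous fun x => C * Real.exp (-γ * x)).tendsto 0).mono_left
        nhdsWithin_le_nhds
    rw [mul_zero, Real.exp_zero, mul_one] at hlim
    refine le_of_tendsto hlim ?_
    filter_upwards [self_mem_nhdsWithin] with x hx
    have h := (hC x hx).trans (integral_exp_mul_le hγ hx (hint x hx) hpos)
    rw [hI x hx, ← mul_assoc] at h
    exact le_of_mul_le_mul_right (by rwa [one_mul])
      (powStruve_pos (ν + 1) (show -3 / 2 < ν + 1 by linarith) hx)

theorem theorem2p1 (n γ ν : ℝ) (hn : -1 < n) (hγ : 0 ≤ γ) :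
    -- existence of the integrals
    (-(n + 2) / 2 < ν → ∀ x : ℝ, 0 < x →
      IntervalIntegrable (fun t : ℝ => Real.exp (-γ * t) * t ^ ν * struveL (ν + n) t)
        MeasureTheory.volume 0 x) ∧
    (-3 / 2 < ν → ∀ x : ℝ, 0 < x →
      IntervalIntegrable (fun t : ℝ => Real.exp (-γ * t) * t ^ (ν + 1) * struveL ν t)
        MeasureTheory.volume 0 x) ∧
    -- (1) lower bound, with best possible constant when `γ = 0`
    (-(n + 2) / 2 < ν →
      (∀ x : ℝ, 0 < x →
        Real.exp (-γ * x) * x ^ ν * struveL (ν + n + 1) x <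
          (∫ t in (0 : ℝ)..x, Real.exp (-γ * t) * t ^ ν * struveL (ν + n) t)) ∧
      (γ = 0 → ∀ C : ℝ,
        (∀ x : ℝ, 0 < x →
          C * (Real.exp (-γ * x) * x ^ ν * struveL (ν + n + 1) x) ≤
            (∫ t in (0 : ℝ)..x, Real.exp (-γ * t) * t ^ ν * struveL (ν + n) t)) →
        C ≤ 1)) ∧
    -- (2) upper bound, with best possible constant
    (1 / 2 ≤ ν →
      (∀ x : ℝ, 0 < x →
        (∫ t in (0 : ℝ)..x, t ^ ν * struveL ν t) < x ^ ν * struveL ν x) ∧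
      (∀ C : ℝ,
        (∀ x : ℝ, 0 < x →
          (∫ t in (0 : ℝ)..x, t ^ ν * struveL ν t) ≤ C * (x ^ ν * struveL ν x)) →
        1 ≤ C)) ∧
    -- (3) upper bound, with best possible constant `1 / (2 * ν + n + 1)`
    (-(n + 1) / 2 < ν →
      (∀ x : ℝ, 0 < x →
        (∫ t in (0 : ℝ)..x, t ^ ν * struveL (ν + n) t) <
          x ^ ν / (2 * ν + n + 1) *
            (2 * (ν + n + 1) * struveL (ν + n + 1) x - (n + 1) * struveL (ν + n + 3) x
              - (n + 1) * x ^ (ν + n + 2) /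
                (√Real.pi * 2 ^ (ν + n + 1) * (2 * ν + n + 2) *
                  Real.Gamma (ν + n + 5 / 2)))) ∧
      (∀ C : ℝ,
        (∀ x : ℝ, 0 < x →
          (∫ t in (0 : ℝ)..x, t ^ ν * struveL (ν + n) t) ≤
            C * (x ^ ν *
              (2 * (ν + n + 1) * struveL (ν + n + 1) x - (n + 1) * struveL (ν + n + 3) x
                - (n + 1) * x ^ (ν + n + 2) /
                  (√Real.pi * 2 ^ (ν + n + 1) * (2 * ν + n + 2) *
                    Real.Gamma (ν + n + 5 / 2))))) →
        1 / (2 * ν + n + 1) ≤ C)) ∧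
    -- (4) upper bound, case of equality, best possible constant `1 / (1 - γ)`
    (γ < 1 → 1 / 2 ≤ ν →
      (∀ x : ℝ, 0 < x →
        (∫ t in (0 : ℝ)..x, Real.exp (-γ * t) * t ^ ν * struveL ν t) ≤
          Real.exp (-γ * x) / (1 - γ) * (∫ t in (0 : ℝ)..x, t ^ ν * struveL ν t)) ∧
      (∀ x : ℝ, 0 < x →
        ((∫ t in (0 : ℝ)..x, Real.exp (-γ * t) * t ^ ν * struveL ν t) =
          Real.exp (-γ * x) / (1 - γ) * (∫ t in (0 : ℝ)..x, t ^ ν * struveL ν t)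
          ↔ γ = 0)) ∧
      (∀ C : ℝ,
        (∀ x : ℝ, 0 < x →
          (∫ t in (0 : ℝ)..x, Real.exp (-γ * t) * t ^ ν * struveL ν t) ≤
            C * (Real.exp (-γ * x) * (∫ t in (0 : ℝ)..x, t ^ ν * struveL ν t))) →
        1 / (1 - γ) ≤ C)) ∧
    -- (5) upper bound, with best possible constant `1 / ((2 * ν + 1) * (1 - γ))`
    (γ < 1 → 1 / 2 ≤ ν →
      (∀ x : ℝ, 0 < x →
        (∫ t in (0 : ℝ)..x, Real.exp (-γ * t) * t ^ ν * struveL ν t) <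
          Real.exp (-γ * x) * x ^ ν / ((2 * ν + 1) * (1 - γ)) *
            (2 * (ν + 1) * struveL (ν + 1) x - struveL (ν + 3) x
              - x ^ (ν + 2) /
                (√Real.pi * 2 ^ (ν + 2) * (ν + 1) * Real.Gamma (ν + 5 / 2)))) ∧
      (∀ C : ℝ,
        (∀ x : ℝ, 0 < x →
          (∫ t in (0 : ℝ)..x, Real.exp (-γ * t) * t ^ ν * struveL ν t) ≤
            C * (Real.exp (-γ * x) * x ^ ν *
              (2 * (ν + 1) * struveL (ν + 1) x - struveL (ν + 3) x
                - x ^ (ν + 2) /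
                  (√Real.pi * 2 ^ (ν + 2) * (ν + 1) * Real.Gamma (ν + 5 / 2))))) →
        1 / ((2 * ν + 1) * (1 - γ)) ≤ C)) ∧
    -- (6) lower bound, case of equality, best possible constant
    (-3 / 2 < ν →
      (∀ x : ℝ, 0 < x →
        Real.exp (-γ * x) * x ^ (ν + 1) * struveL (ν + 1) x ≤
          (∫ t in (0 : ℝ)..x, Real.exp (-γ * t) * t ^ (ν + 1) * struveL ν t)) ∧
      (∀ x : ℝ, 0 < x →
        ((∫ t in (0 : ℝ)..x, Real.exp (-γ * t) * t ^ (ν + 1) * struveL ν t) =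
          Real.exp (-γ * x) * x ^ (ν + 1) * struveL (ν + 1) x ↔ γ = 0)) ∧
      (∀ C : ℝ,
        (∀ x : ℝ, 0 < x →
          C * (Real.exp (-γ * x) * x ^ (ν + 1) * struveL (ν + 1) x) ≤
            (∫ t in (0 : ℝ)..x, Real.exp (-γ * t) * t ^ (ν + 1) * struveL ν t)) →
        C ≤ 1)) ∧
    -- (7) upper bound, case of equality, best possible constant `1 / (1 - γ)`
    (γ < 1 → -1 / 2 < ν →
      (∀ x : ℝ, 0 < x →
        (∫ t in (0 : ℝ)..x, Real.exp (-γ * t) * t ^ (ν + 1) * struveL ν t) ≤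
          1 / (1 - γ) * (Real.exp (-γ * x) * x ^ (ν + 1) * struveL (ν + 1) x)) ∧
      (∀ x : ℝ, 0 < x →
        ((∫ t in (0 : ℝ)..x, Real.exp (-γ * t) * t ^ (ν + 1) * struveL ν t) =
          1 / (1 - γ) * (Real.exp (-γ * x) * x ^ (ν + 1) * struveL (ν + 1) x)
          ↔ γ = 0)) ∧
      (∀ C : ℝ,
        (∀ x : ℝ, 0 < x →
          (∫ t in (0 : ℝ)..x, Real.exp (-γ * t) * t ^ (ν + 1) * struveL ν t) ≤
            C * (Real.exp (-γ * x) * x ^ (ν + 1) * struveL (ν + 1) x)) →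
        1 / (1 - γ) ≤ C)) := by
  have hprim : ∀ {μ : ℝ}, 1 / 2 ≤ μ → ∀ {x : ℝ}, 0 < x →
      ∫ t in (0 : ℝ)..x, powStruve μ μ t = powStruvePrim μ μ x := fun hμ _ hx =>
    integral_powStruve (by linarith) (by linarith) hx
  have hsimp : ∀ μ t : ℝ, t ^ μ * struveL μ t = powStruve μ μ t := fun _ _ => rfl
  simp only [exp_mul_rpow_mul_struveL]
  refine ⟨fun hν x hx => ?_, fun hν x hx => ?_, damped_integral_lower_bound hn hγ,
    integral_lt_and_sharp, fun hν => ?_, fun hγ1 hν => ?_, fun hγ1 hν => ?_,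
    damped_integral_order_lower_bound hγ, fun hγ1 hν => ?_⟩
  · exact intervalIntegrable_exp_mul γ
      (intervalIntegrable_powStruve (by linarith) (by linarith) hx)
  · exact intervalIntegrable_exp_mul γ
      (intervalIntegrable_powStruve (by linarith) (by linarith) hx)
  · obtain ⟨h1, h2⟩ := integral_lt_majorant_and_sharp hn hν
    refine ⟨fun x hx => (h1 x hx).trans_eq ?_, h2⟩
    rw [struveMajorant]
    ring
  · obtain ⟨h1, h2⟩ := powStruvePrim_lt_and_tendsto hν
    obtain ⟨h3, h4, h5⟩ := damped_integral_upper_bound (by linarith) (by linarith) h1 h2 hγ hγ1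
    have e : ∀ x : ℝ, 0 < x →
        Real.exp (-γ * x) / (1 - γ) * (∫ t in (0 : ℝ)..x, t ^ ν * struveL ν t) =
          1 / (1 - γ) * (Real.exp (-γ * x) * powStruvePrim ν ν x) := fun x hx => by
      rw [← hprim hν hx]
      simp only [hsimp]
      ring
    refine ⟨fun x hx => ?_, fun x hx => ?_, fun C hC => ?_⟩
    · rw [e x hx]
      exact h3 x hx
    · rw [e x hx]
      exact h4 x hx
    · have h := h5 (powStruvePrim ν ν) 1 one_pos ?_ C fun x hx => ?_
      · rwa [one_mul] at h
      · refine tendsto_const_nhds.congr' ?_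
        filter_upwards [eventually_gt_atTop (0 : ℝ)] with x hx
        rw [div_self (powStruvePrim_pos (by linarith) (by linarith) hx).ne']
      · rw [← hprim hν hx]
        exact hC x hx
  · obtain ⟨h1, h2⟩ := powStruvePrim_lt_and_tendsto hν
    obtain ⟨h3, -, h5⟩ := damped_integral_upper_bound (by linarith) (by linarith) h1 h2 hγ hγ1
    have hγ' : 0 < 1 - γ := sub_pos.2 hγ1
    have hν' : -((0 : ℝ) + 1) / 2 < ν := by linarith
    have hs : 0 < 2 * ν + 1 := by linarith
    -- The bracket is the three-term majorant for `n = 0`.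
    have e : ∀ x : ℝ, x ^ ν * (2 * (ν + 1) * struveL (ν + 1) x - struveL (ν + 3) x
        - x ^ (ν + 2) / (√Real.pi * 2 ^ (ν + 2) * (ν + 1) * Real.Gamma (ν + 5 / 2))) =
          struveMajorant 0 ν x := fun x => by
      rw [struveMajorant, show ν + 2 = ν + 1 + 1 by ring, Real.rpow_add_one two_ne_zero]
      simp only [add_zero, zero_add, one_mul]
      rw [show ν + 1 + 1 = ν + 2 by ring]
      ring_nf
    refine ⟨fun x hx => ?_, fun C hC => ?_⟩
    · rw [div_mul_eq_mul_div, mul_assoc, e x]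
      refine (h3 x hx).trans_lt ?_
      have h := mul_powStruvePrim_lt_struveMajorant (n := 0) (by norm_num) hν' hx
      rw [add_zero, add_zero] at h
      rw [one_div_mul_eq_div, div_lt_div_iff₀ hγ' (by positivity)]
      have h' := mul_lt_mul_of_pos_left h (mul_pos hγ' (Real.exp_pos (-γ * x)))
      linarith
    · have hlim := tendsto_struveMajorant_div (n := 0) (by norm_num) hν'
      simp only [add_zero] at hlim
      refine h5 (struveMajorant 0 ν) _ hs hlim C fun x hx => ?_
      rw [← e x, ← mul_assoc (Real.exp _)]
      exact hC x hx
  · obtain ⟨h1, h2⟩ := powStruvePrim_add_one_lt_and_tendsto hν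
    obtain ⟨h3, h4, h5⟩ := damped_integral_upper_bound (by linarith) (by linarith) h1 h2 hγ hγ1
    have e : ∀ x : ℝ, 0 < x → powStruvePrim (ν + 1) ν x = powStruve (ν + 1) (ν + 1) x :=
      fun x hx => powStruvePrim_add_one (by linarith) hx
    refine ⟨fun x hx => ?_, fun x hx => ?_, fun C hC => ?_⟩
    · rw [← e x hx]
      exact h3 x hx
    · rw [← e x hx]
      exact h4 x hx
    · have h := h5 (powStruvePrim (ν + 1) ν) 1 one_pos ?_ C fun x hx => ?_
      · rwa [one_mul] at h
      · refine tendsto_const_nhds.congr' ?_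
        filter_upwards [eventually_gt_atTop (0 : ℝ)] with x hx
        rw [div_self (powStruvePrim_pos (by linarith) (by linarith) hx).ne']
      · rw [e x hx]
        exact hC x hx
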